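/- **Theorem.** Let $m\ge 0$, $a\in\mathbb{R}$, $v\in\mathbb{R}^m$, $A_0\in M_m(\mathbb{R})$, and put $$A=\begin{pmatrix} a & v^t\\ 0 & A_0\end{pmatrix}.$$ Let $\mathfrak{g}_A=\mathbb{R}f_1\ltimes_A\mathbb{R}^{m+1}$ be the almost abelian real Lie algebra with bracket $[f_1,u]=Au$ and $[u,w]=0$ for $u,w\in\mathbb{R}^{m+1}$. (Every almost abelian Lie algebra that admits a symplectic form is isomorphic to one of this shape.) Assume that - $\mathfrak{g}_A$ is completely solvable, i.e. solvable with all operators $\operatorname{ad}_x$ having only real eigenvalues; - $\mathfrak{g}_A$ is unimodular, i.e. $\operatorname{tr}(\operatorname{ad}_x)=0$ for all $x\in\mathfrak{g}_A$; - $0\notin\operatorname{spec}(A_0)$; - $A_0$ has nonzero nilpotent part, i.e. $N\neq 0$ in the Jordan decomposition $A_0=S+N$ with $S$ semisimple, $N$ nilpotent and $SN=NS$. Let $\omega\in\bigwedge^2\mathfrak{g}_A^*$ be any symplectic form on $\mathfrak{g}_A$, i.e. a non-degenerate $2$-form with $d\omega=0$, where $d$ is the derivation of $\bigwedge^*\mathfrak{g}_A^*$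 with $d(\alpha\wedge\beta)=d\alpha\wedge\beta+(-1)^{p}\alpha\wedge d\beta$ for $\alpha\in\bigwedge^p\mathfrak{g}_A^*$ and $d\theta(x,y)=-\theta([x,y])$ for $\theta\in\mathfrak{g}_A^*$. Write $\dim\mathfrak{g}_A=2n$, let $H^*(\mathfrak{g}_A)$ be the cohomology of $(\bigwedge^*\mathfrak{g}_A^*,d)$, and for $0\le k\le n$ consider the Lefschetz operator at degree $k$, $$L_{n-k}\colon H^k(\mathfrak{g}_A)\to H^{2n-k}(\mathfrak{g}_A),\qquad [\alpha]\mapsto[\omega^{n-k}\wedge\alpha].$$ Then $\omega$ does not satisfy the hard-Lefschetz condition, i.e. not all $L_{n-k}$ with $0\le k\le n$ are isomorphisms. More precisely, the condition fails at degree $2$: $2\le n$ and $L_{n-2}\colon H^2(\mathfrak{g}_A)\to H^{2n-2}(\mathfrak{g}_A)$ has nontrivial kernel. It does not fail at degree $1$: $L_{n-1}\colon H^1(\mathfrak{g}_A)\to H^{2n-1}(\mathfrak{g}_A)$ has trivial kernel, and indeed is an isomorphism. -/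

import Mathlib

/-! Left-invariant differential forms on a finite-dimensional real Lie algebra `g`: the exterior
algebra `⋀* g*` with the wedge product as multiplication, the standard (Chevalley-Eilenberg)
differential, its cohomology, symplectic forms and Lefschetz operators; and the almost abelian
Lie algebras `ℝ ⋉_A ℝ^ι`. -/

namespace LieForms

noncomputable section

open Module

section Differential

variable (g : Type*) [LieRing g] [LieAlgebra ℝ g]

/-- `⋀* g*`; the multiplication is the wedge product. -/
abbrev Forms : Type _ := ExteriorAlgebra ℝ (Dual ℝ g)

/-- The space `⋀^k g*` of `k`-forms, as a subspace of `⋀* g*`. -/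
abbrev formsOfDegree (k : ℕ) : Submodule ℝ (Forms g) := ⋀[ℝ]^k (Dual ℝ g)

variable {g}

/-- Contraction `i_x` of a form with the vector `x`. -/
def contract (x : g) : Forms g →ₗ[ℝ] Forms g :=
  CliffordAlgebra.contractLeft (Q := (0 : QuadraticForm ℝ (Dual ℝ g))) (Dual.eval ℝ g x)

/-- The value `η(x, y)` of a `2`-form `η`, so that
`(α ∧ β)(x, y) = α(x) β(y) - α(y) β(x)` for `1`-forms `α`, `β`. -/
def eval₂ (η : Forms g) (x y : g) : ℝ :=
  ExteriorAlgebra.algebraMapInv (contract y (contract x η))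

theorem contract_ι_mul (x : g) (α : Dual ℝ g) (η : Forms g) :
    contract x (ExteriorAlgebra.ι ℝ α * η)
      = α x • η - ExteriorAlgebra.ι ℝ α * contract x η := by
  exact CliffordAlgebra.contractLeft_ι_mul (Q := (0 : QuadraticForm ℝ (Dual ℝ g)))
    (d := Dual.eval ℝ g x) α η

theorem contract_ι (x : g) (α : Dual ℝ g) :
    contract x (ExteriorAlgebra.ι ℝ α) = algebraMap ℝ _ (α x) := by
  exact CliffordAlgebra.contractLeft_ι (Q := (0 : QuadraticForm ℝ (Dual ℝ g)))
    (d := Dual.eval ℝ g x) α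

theorem eval₂_ι_mul_ι (α β : Dual ℝ g) (x y : g) :
    eval₂ (ExteriorAlgebra.ι ℝ α * ExteriorAlgebra.ι ℝ β) x y = α x * β y - α y * β x := by
  have h : contract y (ExteriorAlgebra.ι ℝ α * algebraMap ℝ (Forms g) (β x))
      = algebraMap ℝ _ (α y * β x) := by
    rw [← Algebra.commutes, ← Algebra.smul_def, map_smul, contract_ι, Algebra.smul_def,
      ← map_mul, mul_comm]
  simp only [eval₂, contract_ι_mul, contract_ι, map_sub, map_smul, h,
    ExteriorAlgebra.algebraMap_leftInverse _ _, smul_eq_mul]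

theorem involute_of_mem {k : ℕ} {η : Forms g} (h : η ∈ formsOfDegree g k) :
    CliffordAlgebra.involute η = (-1 : ℝ) ^ k • η := by
  induction h using Submodule.pow_induction_on_left' with
  | algebraMap r => simp
  | add x y i _ _ hx hy => rw [map_add, hx, hy, smul_add]
  | mem_mul m hm i x hx ih =>
    obtain ⟨θ, rfl⟩ := hm
    have h : CliffordAlgebra.involute (ExteriorAlgebra.ι ℝ θ : Forms g)
      = -ExteriorAlgebra.ι ℝ θ := CliffordAlgebra.involute_ι θ
    rw [map_mul, ih, h, pow_succ]
    simp

variable (g) [Module.Finite ℝ g]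

/-- The differential on `1`-forms, `(dθ)(x, y) = -θ([x, y])`, written in a basis `(e_i)` of `g` as
`dθ = -1/2 ∑ θ([e_i, e_j]) e^i ∧ e^j`; see `eval₂_dOne`. -/
def dOne : Dual ℝ g →ₗ[ℝ] Forms g :=
  ∑ i, ∑ j, LinearMap.smulRight (Dual.eval ℝ g ⁅finBasis ℝ g i, finBasis ℝ g j⁆)
    (-(1 / 2 : ℝ) • (ExteriorAlgebra.ι ℝ ((finBasis ℝ g).coord i)
      * ExteriorAlgebra.ι ℝ ((finBasis ℝ g).coord j)))

variable {g}

theorem dOne_apply (θ : Dual ℝ g) :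
    dOne g θ = ∑ i, ∑ j, θ ⁅finBasis ℝ g i, finBasis ℝ g j⁆ •
      (-(1 / 2 : ℝ) • (ExteriorAlgebra.ι ℝ ((finBasis ℝ g).coord i)
        * ExteriorAlgebra.ι ℝ ((finBasis ℝ g).coord j))) := by
  simp [dOne, LinearMap.sum_apply]

theorem dOne_mem (θ : Dual ℝ g) : dOne g θ ∈ formsOfDegree g 2 := by
  rw [dOne_apply]
  refine Submodule.sum_mem _ fun i _ => Submodule.sum_mem _ fun j _ =>
    Submodule.smul_mem _ _ (Submodule.smul_mem _ _ ?_)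
  change _ ∈ LinearMap.range (ExteriorAlgebra.ι ℝ) ^ 2
  rw [pow_two]
  exact Submodule.mul_mem_mul ⟨_, rfl⟩ ⟨_, rfl⟩

theorem eval₂_dOne (θ : Dual ℝ g) (x y : g) : eval₂ (dOne g θ) x y = -θ ⁅x, y⁆ := by
  set b := finBasis ℝ g with hb
  have hbr : ∀ u w : g, θ ⁅u, w⁆ = ∑ i, ∑ j, b.coord i u * b.coord j w * θ ⁅b i, b j⁆ := by
    intro u w
    conv_lhs => rw [← b.sum_repr u, ← b.sum_repr w]
    simp only [sum_lie, lie_sum, lie_smul, smul_lie, map_sum, map_smul,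
      smul_eq_mul, Basis.coord_apply, Finset.mul_sum]
    rw [Finset.sum_comm]
    refine Finset.sum_congr rfl fun i _ => Finset.sum_congr rfl fun j _ => by ring
  have h1 : eval₂ (dOne g θ) x y = ∑ i, ∑ j, θ ⁅b i, b j⁆ *
      (-(1 / 2 : ℝ) * (b.coord i x * b.coord j y - b.coord i y * b.coord j x)) := by
    rw [dOne_apply]
    simp only [← eval₂_ι_mul_ι]
    simp only [eval₂, map_sum, map_smul, smul_eq_mul]
    rfl
  have h2 : θ ⁅y, x⁆ = -θ ⁅x, y⁆ := by rw [← lie_skew y x, map_neg]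
  have h3 : eval₂ (dOne g θ) x y = -(1 / 2) * (θ ⁅x, y⁆ - θ ⁅y, x⁆) := by
    rw [h1, hbr x y, hbr y x, ← Finset.sum_sub_distrib, Finset.mul_sum]
    refine Finset.sum_congr rfl fun i _ => ?_
    rw [← Finset.sum_sub_distrib, Finset.mul_sum]
    exact Finset.sum_congr rfl fun j _ => by ring
  rw [h3, h2]
  ring

/-- `2`-forms commute with `1`-forms. -/
theorem ι_mul_dOne (α θ : Dual ℝ g) :
    ExteriorAlgebra.ι ℝ α * dOne g θ = dOne g θ * ExteriorAlgebra.ι ℝ α := by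
  have hanti : ∀ β γ : Dual ℝ g, ExteriorAlgebra.ι ℝ β * ExteriorAlgebra.ι ℝ γ
      = -(ExteriorAlgebra.ι ℝ γ * ExteriorAlgebra.ι ℝ β) := fun β γ =>
    eq_neg_of_add_eq_zero_left (ExteriorAlgebra.ι_add_mul_swap β γ)
  rw [dOne_apply]
  simp only [Finset.mul_sum, Finset.sum_mul, mul_smul_comm, smul_mul_assoc]
  refine Finset.sum_congr rfl fun i _ => Finset.sum_congr rfl fun j _ => ?_
  rw [← mul_assoc, hanti α, neg_mul, mul_assoc, hanti α, mul_neg, neg_neg, mul_assoc]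

variable (g)

/-- The algebra homomorphism `η ↦ [[η^, dη], [0, η]]`, where `η^ = (-1)^k η` for a `k`-form `η`,
that sends a `1`-form `θ` to `[[-θ, dθ], [0, θ]]`; its upper right entry is a graded derivation. -/
def dHom : Forms g →ₐ[ℝ] Matrix (Fin 2) (Fin 2) (Forms g) :=
  ExteriorAlgebra.lift ℝ
    ⟨{ toFun := fun θ => !![-ExteriorAlgebra.ι ℝ θ, dOne g θ; 0, ExteriorAlgebra.ι ℝ θ]
       map_add' := fun θ η => by
        ext i j; fin_cases i <;> fin_cases j <;> simp [add_comm]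
       map_smul' := fun c θ => by
        ext i j; fin_cases i <;> fin_cases j <;> simp }, fun θ => by
      ext i j
      fin_cases i <;> fin_cases j <;>
        simp [Matrix.mul_apply, Fin.sum_univ_two, ι_mul_dOne]⟩

/-- The exterior derivative `d` on `⋀* g*`: the graded derivation (see `d_mul`) that is given on
`1`-forms by `(dθ)(x, y) = -θ([x, y])` (see `d_ι` and `eval₂_dOne`). -/
def d : Forms g →ₗ[ℝ] Forms g :=
  (Matrix.entryLinearMap ℝ (Forms g) (0 : Fin 2) (1 : Fin 2)) ∘ₗ (dHom g).toLinearMap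

variable {g}

theorem dHom_ι (θ : Dual ℝ g) : dHom g (ExteriorAlgebra.ι ℝ θ)
    = !![-ExteriorAlgebra.ι ℝ θ, dOne g θ; 0, ExteriorAlgebra.ι ℝ θ] := by
  simp [dHom]

theorem dHom_eq (η : Forms g) :
    dHom g η = !![CliffordAlgebra.involute η, d g η; 0, η] := by
  induction η using ExteriorAlgebra.induction with
  | algebraMap r =>
    ext i j
    fin_cases i <;> fin_cases j <;> simp [d, Matrix.algebraMap_eq_diagonal]
  | ι θ =>
    have h : CliffordAlgebra.involute (ExteriorAlgebra.ι ℝ θ : Forms g)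
      = -ExteriorAlgebra.ι ℝ θ := CliffordAlgebra.involute_ι θ
    simp [d, dHom_ι, h]
  | mul a b ha hb =>
    have h01 : dHom g (a * b) 0 1 = d g (a * b) := rfl
    rw [map_mul] at h01 ⊢
    rw [← h01, ha, hb]
    ext i j
    fin_cases i <;> fin_cases j <;> simp [Matrix.mul_apply, Fin.sum_univ_two]
  | add a b ha hb =>
    rw [map_add, ha, hb]
    ext i j
    fin_cases i <;> fin_cases j <;> simp

theorem d_ι (θ : Dual ℝ g) : d g (ExteriorAlgebra.ι ℝ θ) = dOne g θ := by
  simp [d, dHom_ι]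

/-- Graded Leibniz rule; `involute` is multiplication by `(-1)^k` on `k`-forms. -/
theorem d_mul (a b : Forms g) :
    d g (a * b) = d g a * b + CliffordAlgebra.involute a * d g b := by
  have h01 : dHom g (a * b) 0 1 = d g (a * b) := rfl
  rw [← h01, map_mul, dHom_eq, dHom_eq]
  simp [Matrix.mul_apply, Fin.sum_univ_two, add_comm]

theorem d_mem {k : ℕ} {η : Forms g} (h : η ∈ formsOfDegree g k) :
    d g η ∈ formsOfDegree g (k + 1) := by
  induction h using Submodule.pow_induction_on_left' with
  | algebraMap r =>
    have : d g (algebraMap ℝ (Forms g) r) = 0 := by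
      simp [d, Matrix.algebraMap_eq_diagonal]
    rw [this]
    exact Submodule.zero_mem _
  | add x y i _ _ hx hy => rw [map_add]; exact Submodule.add_mem _ hx hy
  | mem_mul m hm i x hx ih =>
    obtain ⟨θ, rfl⟩ := hm
    have h : CliffordAlgebra.involute (ExteriorAlgebra.ι ℝ θ : Forms g)
      = -ExteriorAlgebra.ι ℝ θ := CliffordAlgebra.involute_ι θ
    rw [d_mul, h, d_ι]
    refine Submodule.add_mem _ ?_ ?_
    · have := Submodule.mul_mem_mul (dOne_mem θ) hx
      rw [← pow_add] at this
      rwa [show 2 + i = i + 1 + 1 by ring] at this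
    · change _ ∈ LinearMap.range (ExteriorAlgebra.ι ℝ) ^ (i + 1 + 1)
      rw [neg_mul, pow_succ']
      exact Submodule.neg_mem _ (Submodule.mul_mem_mul ⟨θ, rfl⟩ ih)

theorem d_dOne (θ : Dual ℝ g) : d g (dOne g θ) = 0 := by
  set b := finBasis ℝ g with hb
  set e : Fin (finrank ℝ g) → Forms g := fun i => ExteriorAlgebra.ι ℝ (b.coord i) with he
  have hd : ∀ i, d g (e i) = dOne g (b.coord i) := fun i => d_ι _
  have hinv : ∀ i, CliffordAlgebra.involute (e i) = -e i := fun i =>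
    CliffordAlgebra.involute_ι (b.coord i)
  have hcomm : ∀ i j, e i * dOne g (b.coord j) = dOne g (b.coord j) * e i := fun i j =>
    ι_mul_dOne _ _
  have hskew : ∀ i j, θ ⁅b j, b i⁆ = -θ ⁅b i, b j⁆ := fun i j => by
    rw [← lie_skew (b j) (b i), map_neg]
  have hanti : ∀ i j, e i * e j = -(e j * e i) := fun i j =>
    eq_neg_of_add_eq_zero_left (ExteriorAlgebra.ι_add_mul_swap _ _)
  have h1 : d g (dOne g θ) = -∑ i, ∑ j, θ ⁅b i, b j⁆ • (dOne g (b.coord i) * e j) := by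
    have h : d g (dOne g θ) = ∑ i, ∑ j, (θ ⁅b i, b j⁆ •
        (-(1 / 2 : ℝ) • (dOne g (b.coord i) * e j))
          + θ ⁅b i, b j⁆ • ((1 / 2 : ℝ) • (dOne g (b.coord j) * e i))) := by
      rw [dOne_apply]
      simp only [map_sum, map_smul]
      refine Finset.sum_congr rfl fun i _ => Finset.sum_congr rfl fun j _ => ?_
      have := d_mul (e i) (e j)
      rw [hd, hd, hinv, neg_mul, hcomm] at this
      rw [← smul_add]
      congr 1
      change -(1 / 2 : ℝ) • d g (e i * e j) = _
      rw [this]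
      module
    rw [h]
    simp only [Finset.sum_add_distrib]
    rw [Finset.sum_comm (f := fun i j => θ ⁅b i, b j⁆ • ((1 / 2 : ℝ) • (dOne g (b.coord j) * e i))),
      ← Finset.sum_add_distrib, ← Finset.sum_neg_distrib]
    refine Finset.sum_congr rfl fun i _ => ?_
    rw [← Finset.sum_add_distrib, ← Finset.sum_neg_distrib]
    refine Finset.sum_congr rfl fun j _ => ?_
    rw [hskew i j]
    module
  have h2 : ∀ j, ∑ i, θ ⁅b i, b j⁆ • (dOne g (b.coord i) * e j)
      = -(1 / 2 : ℝ) • ∑ k, ∑ l, θ ⁅⁅b k, b l⁆, b j⁆ • (e k * e l * e j) := by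
    intro j
    have h : ∀ z : g, θ ⁅z, b j⁆ = ∑ i, b.coord i z * θ ⁅b i, b j⁆ := by
      intro z
      conv_lhs => rw [← b.sum_repr z]
      simp only [sum_lie, smul_lie, map_sum, map_smul, smul_eq_mul, Basis.coord_apply]
    simp only [dOne_apply, Finset.sum_mul, Finset.smul_sum]
    rw [Finset.sum_comm]
    refine Finset.sum_congr rfl fun k _ => ?_
    rw [Finset.sum_comm]
    refine Finset.sum_congr rfl fun l _ => ?_
    rw [h, Finset.sum_smul, Finset.smul_sum]
    refine Finset.sum_congr rfl fun i _ => ?_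
    simp only [smul_mul_assoc, smul_smul]
    congr 1
    ring
  set S := ∑ j, ∑ k, ∑ l, θ ⁅⁅b k, b l⁆, b j⁆ • (e k * e l * e j) with hS
  have hcyc : ∀ k l j, e k * e l * e j = e l * e j * e k := fun k l j => by
    rw [hanti k l, neg_mul, mul_assoc, hanti k j, mul_neg, neg_neg, mul_assoc]
  have hrot : ∀ F : Fin (finrank ℝ g) → Fin (finrank ℝ g) → Fin (finrank ℝ g) → Forms g,
      ∑ j, ∑ k, ∑ l, F j k l = ∑ j, ∑ k, ∑ l, F k l j := fun F => by
    rw [Finset.sum_comm (f := fun j k => ∑ l, F k l j)]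
    exact Finset.sum_congr rfl fun k _ => Finset.sum_comm
  have hS1 : S = ∑ j, ∑ k, ∑ l, θ ⁅⁅b l, b j⁆, b k⁆ • (e k * e l * e j) := by
    rw [hS, hrot]
    exact Finset.sum_congr rfl fun j _ => Finset.sum_congr rfl fun k _ =>
      Finset.sum_congr rfl fun l _ => by rw [hcyc k l j]
  have hS2 : S = ∑ j, ∑ k, ∑ l, θ ⁅⁅b j, b k⁆, b l⁆ • (e k * e l * e j) := by
    rw [hS, hrot, hrot]
    exact Finset.sum_congr rfl fun j _ => Finset.sum_congr rfl fun k _ =>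
      Finset.sum_congr rfl fun l _ => by rw [hcyc j k l]
  have h3 : (3 : ℝ) • S = 0 := by
    have : (3 : ℝ) • S = S + S + S := by module
    rw [this]
    nth_rw 2 [hS1]
    nth_rw 2 [hS2]
    rw [hS]
    simp only [← Finset.sum_add_distrib, ← add_smul]
    refine Finset.sum_eq_zero fun j _ => Finset.sum_eq_zero fun k _ =>
      Finset.sum_eq_zero fun l _ => ?_
    rw [← map_add, ← map_add]
    have hj : ⁅⁅b k, b l⁆, b j⁆ + ⁅⁅b l, b j⁆, b k⁆ + ⁅⁅b j, b k⁆, b l⁆ = 0 := by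
      rw [← lie_skew ⁅b k, b l⁆ (b j), ← lie_skew ⁅b l, b j⁆ (b k), ← lie_skew ⁅b j, b k⁆ (b l),
        ← neg_add, ← neg_add, neg_eq_zero, ← lie_jacobi (b j) (b k) (b l)]
    rw [hj, map_zero, zero_smul]
  have h4 : S = 0 := (smul_eq_zero_iff_right (by norm_num)).1 h3
  rw [h1, Finset.sum_comm]
  simp only [h2]
  rw [← Finset.smul_sum, ← hS, h4, smul_zero, neg_zero]

theorem d_d (η : Forms g) : d g (d g η) = 0 := by
  have hinv : ∀ η : Forms g,
      d g (CliffordAlgebra.involute η) = -CliffordAlgebra.involute (d g η) := by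
    intro η
    induction η using ExteriorAlgebra.induction with
    | algebraMap r => simp [d, Matrix.algebraMap_eq_diagonal]
    | ι θ =>
      have h : CliffordAlgebra.involute (ExteriorAlgebra.ι ℝ θ : Forms g)
        = -ExteriorAlgebra.ι ℝ θ := CliffordAlgebra.involute_ι θ
      rw [h, map_neg, d_ι, involute_of_mem (dOne_mem θ)]
      simp
    | mul a b ha hb =>
      rw [map_mul, d_mul, d_mul, ha, hb, map_add, map_mul, map_mul,
        CliffordAlgebra.involute_involute]
      noncomm_ring
    | add a b ha hb => rw [map_add, map_add, ha, hb, map_add, map_add, neg_add]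
  induction η using ExteriorAlgebra.induction with
  | algebraMap r => simp [d, Matrix.algebraMap_eq_diagonal]
  | ι θ => rw [d_ι, d_dOne]
  | mul a b ha hb =>
    rw [d_mul, map_add, d_mul, d_mul, ha, hb, hinv, CliffordAlgebra.involute_involute]
    simp
  | add a b ha hb => rw [map_add, map_add, ha, hb, add_zero]

variable (g)

/-- Closed `k`-forms. -/
def cocycles (k : ℕ) : Submodule ℝ (Forms g) := formsOfDegree g k ⊓ LinearMap.ker (d g)

/-- Exact `k`-forms: the image under `d` of the `(k - 1)`-forms (zero for `k = 0`). -/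
def coboundaries : ℕ → Submodule ℝ (Forms g)
  | 0 => ⊥
  | k + 1 => (formsOfDegree g k).map (d g)

theorem coboundaries_le_cocycles (k : ℕ) : coboundaries g k ≤ cocycles g k := by
  cases k with
  | zero => exact bot_le
  | succ k =>
    rintro _ ⟨η, hη, rfl⟩
    exact ⟨d_mem hη, d_d η⟩

/-- The Lie algebra cohomology `H^k(g)` with trivial real coefficients. -/
abbrev Cohomology (k : ℕ) : Type _ :=
  cocycles g k ⧸ (coboundaries g k).submoduleOf (cocycles g k)

variable {g}

/-- A symplectic form on `g`: a closed non-degenerate `2`-form. -/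
structure IsSymplectic (ω : Forms g) : Prop where
  mem : ω ∈ formsOfDegree g 2
  closed : d g ω = 0
  nondegenerate : ∀ x : g, (∀ y : g, eval₂ ω x y = 0) → x = 0

namespace IsSymplectic

variable {ω : Forms g}

theorem pow_mem (hω : IsSymplectic ω) (r : ℕ) : ω ^ r ∈ formsOfDegree g (2 * r) := by
  have := Submodule.pow_mem_pow _ hω.mem r
  rwa [← pow_mul] at this

theorem d_pow_mul (hω : IsSymplectic ω) (r : ℕ) (η : Forms g) :
    d g (ω ^ r * η) = ω ^ r * d g η := by
  induction r with
  | zero => simp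
  | succ r ih =>
    rw [pow_succ', mul_assoc, d_mul, hω.closed, zero_mul, zero_add, ih,
      involute_of_mem hω.mem, mul_assoc]
    simp

theorem pow_mul_mem (hω : IsSymplectic ω) (r : ℕ) {k : ℕ} {η : Forms g}
    (hη : η ∈ formsOfDegree g k) : ω ^ r * η ∈ formsOfDegree g (2 * r + k) := by
  have := Submodule.mul_mem_mul (hω.pow_mem r) hη
  rwa [← pow_add] at this

theorem pow_mul_mem_cocycles (hω : IsSymplectic ω) (r k : ℕ) :
    ∀ η ∈ cocycles g k, LinearMap.mulLeft ℝ (ω ^ r) η ∈ cocycles g (2 * r + k) := by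
  rintro η ⟨hη, hd⟩
  refine ⟨hω.pow_mul_mem r hη, ?_⟩
  have hd' : d g η = 0 := hd
  change d g (ω ^ r * η) = 0
  rw [hω.d_pow_mul, hd', mul_zero]

theorem pow_mul_mem_coboundaries (hω : IsSymplectic ω) (r k : ℕ) :
    ∀ η ∈ coboundaries g k, ω ^ r * η ∈ coboundaries g (2 * r + k) := by
  cases k with
  | zero =>
    intro η hη
    rw [(Submodule.mem_bot ℝ).1 hη, mul_zero]
    exact Submodule.zero_mem _
  | succ k =>
    rintro _ ⟨η, hη, rfl⟩
    exact ⟨ω ^ r * η, hω.pow_mul_mem r hη, hω.d_pow_mul r η⟩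

/-- The map `[α] ↦ [ω^r ∧ α]` from `H^k(g)` to `H^(2r+k)(g)`. -/
def wedgePow (hω : IsSymplectic ω) (r k : ℕ) :
    Cohomology g k →ₗ[ℝ] Cohomology g (2 * r + k) :=
  Submodule.mapQ _ _
    ((LinearMap.mulLeft ℝ (ω ^ r)).restrict (hω.pow_mul_mem_cocycles r k))
    fun η hη => hω.pow_mul_mem_coboundaries r k η hη

/-- For `dim g = 2n` and `k ≤ n`, the Lefschetz operator at degree `k`,
`L_(n-k) : H^k(g) → H^(2n-k)(g)`, `[α] ↦ [ω^(n-k) ∧ α]` (note that `2(n-k) + k = 2n-k`). -/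
def lefschetz (hω : IsSymplectic ω) (k : ℕ) :
    Cohomology g k →ₗ[ℝ] Cohomology g (2 * (finrank ℝ g / 2 - k) + k) :=
  hω.wedgePow (finrank ℝ g / 2 - k) k

/-- The hard-Lefschetz condition: every Lefschetz operator is an isomorphism. -/
def HardLefschetz (hω : IsSymplectic ω) : Prop :=
  ∀ k ≤ finrank ℝ g / 2, Function.Bijective (hω.lefschetz k)

/-- The hard-Lefschetz condition fails at degree `k`: the Lefschetz operator at degree `k`
has a nontrivial kernel. -/
def FailsAt (hω : IsSymplectic ω) (k : ℕ) : Prop :=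
  k ≤ finrank ℝ g / 2 ∧ LinearMap.ker (hω.lefschetz k) ≠ ⊥

end IsSymplectic

end Differential

section Classes

variable (g : Type*) [LieRing g] [LieAlgebra ℝ g]

/-- `tr (ad x) = 0` for all `x`. -/
def IsUnimodular : Prop :=
  ∀ x : g, LinearMap.trace ℝ g (LieAlgebra.ad ℝ g x) = 0

/-- `g` is solvable and all operators `ad x` have only real eigenvalues. -/
def IsCompletelySolvable [Module.Finite ℝ g] : Prop :=
  LieAlgebra.IsSolvable g ∧ ∀ x : g, (LieAlgebra.ad ℝ g x).charpoly.Splits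

end Classes

/-- The nilpotent part `N` in the Jordan decomposition `B = S + N` of the matrix `B`, with `S`
semisimple, `N` nilpotent and `S N = N S`, is nonzero (this decomposition is unique). -/
def HasNonzeroNilpotentPart {ι : Type*} [Fintype ι] [DecidableEq ι] (B : Matrix ι ι ℝ) : Prop :=
  ∃ S N : Matrix ι ι ℝ, Module.End.IsSemisimple (Matrix.toLin' S) ∧ IsNilpotent N ∧ Commute S N ∧
    B = S + N ∧ N ≠ 0

/-- The vector space `ℝ f₁ ⊕ ℝ^ι` underlying the almost abelian Lie algebra `ℝ ⋉_A ℝ^ι`;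
the pair `(s, u)` is `s f₁ + u`. -/
def AlmostAbelian {ι : Type*} [Fintype ι] (_A : Matrix ι ι ℝ) : Type _ := ℝ × (ι → ℝ)

namespace AlmostAbelian

variable {ι : Type*} [Fintype ι] (A : Matrix ι ι ℝ)

instance : AddCommGroup (AlmostAbelian A) := inferInstanceAs (AddCommGroup (ℝ × (ι → ℝ)))

instance : Module ℝ (AlmostAbelian A) := inferInstanceAs (Module ℝ (ℝ × (ι → ℝ)))

instance : Module.Finite ℝ (AlmostAbelian A) :=
  inferInstanceAs (Module.Finite ℝ (ℝ × (ι → ℝ)))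

/-- `[s f₁ + u, t f₁ + w] = s A w - t A u`; that is, `[f₁, u] = A u` and `[u, w] = 0`. -/
instance : Bracket (AlmostAbelian A) (AlmostAbelian A) where
  bracket x y := ((0, x.1 • A.mulVec y.2 - y.1 • A.mulVec x.2) : ℝ × (ι → ℝ))

theorem lie_def (x y : AlmostAbelian A) :
    ⁅x, y⁆ = ((0, x.1 • A.mulVec y.2 - y.1 • A.mulVec x.2) : ℝ × (ι → ℝ)) := rfl

instance : LieRing (AlmostAbelian A) where
  add_lie x y z := by
    refine Prod.ext (add_zero (0 : ℝ)).symm ?_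
    change (x.1 + y.1) • A.mulVec z.2 - z.1 • A.mulVec (x.2 + y.2)
      = (x.1 • A.mulVec z.2 - z.1 • A.mulVec x.2) + (y.1 • A.mulVec z.2 - z.1 • A.mulVec y.2)
    rw [Matrix.mulVec_add]
    module
  lie_add x y z := by
    refine Prod.ext (add_zero (0 : ℝ)).symm ?_
    change x.1 • A.mulVec (y.2 + z.2) - (y.1 + z.1) • A.mulVec x.2
      = (x.1 • A.mulVec y.2 - y.1 • A.mulVec x.2) + (x.1 • A.mulVec z.2 - z.1 • A.mulVec x.2)
    rw [Matrix.mulVec_add]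
    module
  lie_self x := Prod.ext rfl (sub_self _)
  leibniz_lie x y z := by
    refine Prod.ext (add_zero (0 : ℝ)).symm ?_
    change x.1 • A.mulVec (y.1 • A.mulVec z.2 - z.1 • A.mulVec y.2) - (0 : ℝ) • A.mulVec x.2
      = ((0 : ℝ) • A.mulVec z.2 - z.1 • A.mulVec (x.1 • A.mulVec y.2 - y.1 • A.mulVec x.2))
        + (y.1 • A.mulVec (x.1 • A.mulVec z.2 - z.1 • A.mulVec x.2) - (0 : ℝ) • A.mulVec y.2)
    simp only [Matrix.mulVec_sub, Matrix.mulVec_smul]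
    module

instance : LieAlgebra ℝ (AlmostAbelian A) where
  lie_smul t x y := by
    refine Prod.ext (mul_zero t).symm ?_
    change x.1 • A.mulVec (t • y.2) - (t * y.1) • A.mulVec x.2
      = t • (x.1 • A.mulVec y.2 - y.1 • A.mulVec x.2)
    rw [Matrix.mulVec_smul]
    module

end AlmostAbelian

end

end LieForms

/-! Write `φ` for the coordinate of `f₁`, `T = ad f₁`, and `D = derivOf T` for the derivation of the
exterior algebra extending the transpose of `T`. Two facts drive the proof. The differential is `d y
= -φ ∧ D y` (`d_eq`), so every exact form is a multiple of `φ`. On top-degree forms `D` is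
multiplication by `tr T`, which is zero by unimodularity (`derivOf_eq_zero_of_trace`).

A symplectic form is `φ ∧ α + ω₀` with `D ω₀ = 0`. If `A` were invertible, then modulo `φ` one would
have `α = β ∘ T`, and the top power of the form would be a multiple of `D (φ ∧ β ∧ ω₀^(n-1)) = 0`.
Hence `a = 0`. Since `A₀` is invertible, `ker T` is then spanned by `f = f₁` and one vector `e`,
with complement `im T`. Up to an exact form, which does not affect the Lefschetz operators, `ω = c φ
∧ ε + ω₀` with `ω₀` a `T`-invariant form on `im T` (`exists_isNormalForm`).

The key is `pow_mul_derivOf_mem_coboundaries`: if `ζ` is a `k`-form on `im T`, with `k` positive,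
and `r ≥ n - k/2 - 1`, then `ω^r ∧ D ζ` is exact. In degree 2, a Jordan block of `A₀` gives 1-forms
`χ`, `θ` with `χ ∘ T = λ χ + θ` and `θ ∘ T = λ θ`. Contracting `ω₀` with a `λ`-eigenvector gives `ψ`
with `ψ ∘ T = -λ ψ`. Then `θ ∧ ψ = D (χ ∧ ψ)` is closed and not exact, and its product with
`ω^(n-2)` is exact. In degree 1, the closed forms are spanned by `φ` and `ε`, which `ω^(n-1)` pairs
nondegenerately. -/

namespace LieForms

open Module ExteriorAlgebra
open CliffordAlgebra (involute)

noncomputable section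

/-! ### Contractions and derivations of the exterior algebra. -/

section ExteriorCalculus

variable {g : Type*} [LieRing g] [LieAlgebra ℝ g]

@[elab_as_elim]
theorem forms_left_induction {P : Forms g → Prop} (y : Forms g)
    (scalar : ∀ r : ℝ, P (algebraMap ℝ (Forms g) r)) (add : ∀ a b, P a → P b → P (a + b))
    (mul : ∀ (θ : Dual ℝ g) (a : Forms g), P a → P (ι ℝ θ * a)) : P y :=
  CliffordAlgebra.left_induction (Q := (0 : QuadraticForm ℝ (Dual ℝ g))) (P := P) scalar add
    (fun a θ h => mul θ a h) y

theorem ι_anticomm (α β : Dual ℝ g) :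
    (ι ℝ α * ι ℝ β : Forms g) = -(ι ℝ β * ι ℝ α) :=
  eq_neg_of_add_eq_zero_left (ι_add_mul_swap α β)

theorem involute_ι (θ : Dual ℝ g) : involute (ι ℝ θ : Forms g) = -ι ℝ θ :=
  CliffordAlgebra.involute_ι θ

theorem ι_mem_formsOfDegree (θ : Dual ℝ g) : (ι ℝ θ : Forms g) ∈ formsOfDegree g 1 := by
  change _ ∈ LinearMap.range (ι ℝ) ^ 1
  rw [pow_one]
  exact ⟨θ, rfl⟩

theorem exists_ι_of_mem {y : Forms g} (hy : y ∈ formsOfDegree g 1) : ∃ θ, ι ℝ θ = y := by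
  change _ ∈ LinearMap.range (ι ℝ) ^ 1 at hy
  rwa [pow_one] at hy

theorem mul_mem_formsOfDegree {j k : ℕ} {a b : Forms g} (ha : a ∈ formsOfDegree g j)
    (hb : b ∈ formsOfDegree g k) : a * b ∈ formsOfDegree g (j + k) := by
  have := Submodule.mul_mem_mul ha hb
  rwa [← pow_add] at this

theorem pow_mem_formsOfDegree {j : ℕ} {a : Forms g} (ha : a ∈ formsOfDegree g j) (r : ℕ) :
    a ^ r ∈ formsOfDegree g (j * r) := by
  have := Submodule.pow_mem_pow _ ha r
  rwa [← pow_mul] at this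

theorem contract_algebraMap (x : g) (r : ℝ) : contract x (algebraMap ℝ (Forms g) r) = 0 :=
  CliffordAlgebra.contractLeft_algebraMap (Q := (0 : QuadraticForm ℝ (Dual ℝ g)))
    (d := Dual.eval ℝ g x) r

theorem contract_contract (x : g) (y : Forms g) : contract x (contract x y) = 0 :=
  CliffordAlgebra.contractLeft_contractLeft (Q := (0 : QuadraticForm ℝ (Dual ℝ g)))
    (d := Dual.eval ℝ g x) y

theorem contract_comm (x z : g) (y : Forms g) :
    contract x (contract z y) = -contract z (contract x y) :=
  CliffordAlgebra.contractLeft_comm (Q := (0 : QuadraticForm ℝ (Dual ℝ g)))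
    (d := Dual.eval ℝ g x) (d' := Dual.eval ℝ g z) y

theorem contract_add (x z : g) (y : Forms g) :
    contract (x + z) y = contract x y + contract z y := by
  simp [contract]

theorem contract_smul (c : ℝ) (x : g) (y : Forms g) :
    contract (c • x) y = c • contract x y := by
  simp [contract]

theorem contract_zero (y : Forms g) : contract (0 : g) y = 0 := by
  simp [contract]

theorem contract_mul (x : g) (a b : Forms g) :
    contract x (a * b) = contract x a * b + involute a * contract x b := by
  induction a using forms_left_induction with
  | scalar r => simp [← Algebra.smul_def, contract_algebraMap]
  | add a a' h h' => simp only [add_mul, map_add, h, h']; abel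
  | mul θ a h =>
    rw [mul_assoc, contract_ι_mul, h, contract_ι_mul, map_mul, involute_ι, mul_add, sub_mul,
      smul_mul_assoc, neg_mul, neg_mul, ← mul_assoc, ← mul_assoc]
    abel

/-- The sign of moving a 1-form past `a` is exactly the one recorded by `involute`; this is why
`derivOf` obeys an ungraded Leibniz rule. -/
theorem ι_mul_involute (θ : Dual ℝ g) (a : Forms g) : ι ℝ θ * involute a = a * ι ℝ θ := by
  induction a using forms_left_induction with
  | scalar r => rw [AlgHom.commutes, Algebra.commutes]
  | add a a' h h' => rw [map_add, mul_add, h, h', add_mul]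
  | mul φ a h =>
    rw [map_mul, involute_ι, mul_assoc, ← h, neg_mul, mul_neg, ← mul_assoc, ← mul_assoc,
      ι_anticomm, neg_mul, neg_neg]

theorem involute_of_mem_two {a : Forms g} (ha : a ∈ formsOfDegree g 2) : involute a = a := by
  simp [involute_of_mem ha]

theorem commute_of_mem_two {a : Forms g} (ha : a ∈ formsOfDegree g 2) (b : Forms g) :
    Commute a b := by
  change a * b = b * a
  induction b using forms_left_induction with
  | scalar r => exact (Algebra.commutes _ _).symm
  | add b b' h h' => rw [mul_add, h, h', add_mul]
  | mul θ b h =>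
    rw [← mul_assoc, ← ι_mul_involute, involute_of_mem_two ha, mul_assoc, h, mul_assoc]

theorem contract_eq_zero_of_mem_zero (x : g) {y : Forms g} (hy : y ∈ formsOfDegree g 0) :
    contract x y = 0 := by
  change _ ∈ LinearMap.range (ι ℝ) ^ 0 at hy
  rw [pow_zero, Submodule.mem_one] at hy
  obtain ⟨r, rfl⟩ := hy
  exact contract_algebraMap x r

/-- The truncated `k - 1` is harmless at `k = 0`, because contraction kills scalars. -/
theorem contract_mem (x : g) {k : ℕ} {y : Forms g} (hy : y ∈ formsOfDegree g k) :
    contract x y ∈ formsOfDegree g (k - 1) := by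
  induction hy using Submodule.pow_induction_on_left' with
  | algebraMap r => rw [contract_algebraMap]; exact Submodule.zero_mem _
  | add x y i _ _ hx hy => rw [map_add]; exact Submodule.add_mem _ hx hy
  | mem_mul m hm i z hz ih =>
    obtain ⟨θ, rfl⟩ := hm
    rw [contract_ι_mul]
    refine Submodule.sub_mem _ (Submodule.smul_mem _ _ hz) ?_
    rcases i with _ | i
    · rw [contract_eq_zero_of_mem_zero x hz, mul_zero]; exact Submodule.zero_mem _
    · have := mul_mem_formsOfDegree (ι_mem_formsOfDegree θ) ih
      rwa [show 1 + (i + 1 - 1) = i + 1 by omega] at this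

theorem contract_pow {a : Forms g} (ha : a ∈ formsOfDegree g 2) (x : g) (k : ℕ) :
    contract x (a ^ (k + 1)) = (k + 1 : ℝ) • (contract x a * a ^ k) := by
  induction k with
  | zero => simp
  | succ k ih =>
    rw [pow_succ', contract_mul, ih, involute_of_mem_two ha, mul_smul_comm, ← mul_assoc,
      (commute_of_mem_two ha (contract x a)).eq, mul_assoc, ← pow_succ']
    push_cast
    module

/-- A form that is annihilated by multiplication with a `1`-form `θ` and by contraction with
a vector `x` such that `θ(x) = 1` vanishes. -/
theorem eq_zero_of_ι_mul_eq_zero {θ : Dual ℝ g} {x : g} (hθ : θ x = 1) {y : Forms g}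
    (h : ι ℝ θ * y = 0) (hx : contract x y = 0) : y = 0 := by
  have := contract_ι_mul x θ y
  rwa [h, hx, hθ, map_zero, mul_zero, sub_zero, one_smul, eq_comm] at this

variable [Module.Finite ℝ g]

/-- The derivation of `⋀* g*` that extends the transpose of the endomorphism `T` of `g`. -/
def derivOf (T : g →ₗ[ℝ] g) : Forms g →ₗ[ℝ] Forms g :=
  ∑ i, LinearMap.mulLeft ℝ (ι ℝ ((finBasis ℝ g).coord i ∘ₗ T)) ∘ₗ contract (finBasis ℝ g i)

theorem derivOf_apply (T : g →ₗ[ℝ] g) (y : Forms g) :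
    derivOf T y
      = ∑ i, ι ℝ ((finBasis ℝ g).coord i ∘ₗ T) * contract (finBasis ℝ g i) y := by
  simp [derivOf, LinearMap.sum_apply]

theorem derivOf_mul (T : g →ₗ[ℝ] g) (a b : Forms g) :
    derivOf T (a * b) = derivOf T a * b + a * derivOf T b := by
  simp only [derivOf_apply, Finset.sum_mul, Finset.mul_sum, ← Finset.sum_add_distrib]
  refine Finset.sum_congr rfl fun i _ => ?_
  rw [contract_mul, mul_add, ← mul_assoc, ← mul_assoc, ι_mul_involute, mul_assoc a]

theorem derivOf_algebraMap (T : g →ₗ[ℝ] g) (r : ℝ) :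
    derivOf T (algebraMap ℝ (Forms g) r) = 0 := by
  simp [derivOf_apply, contract_algebraMap]

theorem derivOf_ι (T : g →ₗ[ℝ] g) (θ : Dual ℝ g) :
    derivOf T (ι ℝ θ) = ι ℝ (θ ∘ₗ T) := by
  have h : θ ∘ₗ T = ∑ i, θ (finBasis ℝ g i) • ((finBasis ℝ g).coord i ∘ₗ T) := by
    ext x
    have := congrArg θ ((finBasis ℝ g).sum_repr (T x))
    simp only [map_sum, map_smul] at this
    simpa [LinearMap.sum_apply, mul_comm] using this.symm
  rw [derivOf_apply, h, map_sum]
  refine Finset.sum_congr rfl fun i _ => ?_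
  rw [contract_ι, ← Algebra.commutes, ← Algebra.smul_def, map_smul]

theorem derivOf_pow (T : g →ₗ[ℝ] g) {a : Forms g} (h : derivOf T a = 0) (k : ℕ) :
    derivOf T (a ^ k) = 0 := by
  induction k with
  | zero => simpa using derivOf_algebraMap T (1 : ℝ)
  | succ k ih => rw [pow_succ, derivOf_mul, h, ih]; simp

theorem derivOf_id {k : ℕ} {y : Forms g} (hy : y ∈ formsOfDegree g k) :
    derivOf LinearMap.id y = (k : ℝ) • y := by
  induction hy using Submodule.pow_induction_on_left' with
  | algebraMap r => rw [derivOf_algebraMap]; simp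
  | add x y i _ _ hx hy => rw [map_add, hx, hy, smul_add]
  | mem_mul m hm i z hz ih =>
    obtain ⟨θ, rfl⟩ := hm
    rw [derivOf_mul, derivOf_ι, LinearMap.comp_id, ih, mul_smul_comm]
    push_cast
    module

theorem contract_derivOf (T : g →ₗ[ℝ] g) (x : g) (y : Forms g) :
    contract x (derivOf T y) = derivOf T (contract x y) + contract (T x) y := by
  induction y using forms_left_induction with
  | scalar r => simp [derivOf_algebraMap, contract_algebraMap]
  | add a b ha hb => simp only [map_add, ha, hb]; abel
  | mul θ a h =>
    simp only [derivOf_mul, derivOf_ι, contract_ι_mul, map_add, map_sub, map_smul, h,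
      LinearMap.comp_apply, mul_add]
    abel

/-- Contracting `θ ∧ y = 0` with `x` gives `θ ∧ i_x y = θ(x) y`, so the sum defining `derivOf`
collapses to the diagonal entries of `T`. -/
theorem derivOf_eq_trace_smul (T : g →ₗ[ℝ] g) {y : Forms g}
    (hy : ∀ θ : Dual ℝ g, ι ℝ θ * y = 0) : derivOf T y = LinearMap.trace ℝ g T • y := by
  have h : ∀ (x : g) (θ : Dual ℝ g), ι ℝ θ * contract x y = θ x • y := by
    intro x θ
    have := contract_ι_mul x θ y
    rw [hy, map_zero] at this
    exact (sub_eq_zero.1 this.symm).symm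
  simp only [derivOf_apply, h, ← Finset.sum_smul]
  congr 1
  rw [LinearMap.trace_eq_matrix_trace ℝ (finBasis ℝ g), Matrix.trace]
  simp [LinearMap.toMatrix_apply]

/-- The identity acts as the degree by `derivOf_id`, and as its trace, the dimension, by the
preceding lemma. -/
theorem degree_eq_finrank {k : ℕ} {y : Forms g} (hk : y ∈ formsOfDegree g k) (h0 : y ≠ 0)
    (hy : ∀ θ : Dual ℝ g, ι ℝ θ * y = 0) : k = finrank ℝ g := by
  have h := derivOf_eq_trace_smul LinearMap.id hy
  rw [derivOf_id hk, LinearMap.trace_id] at h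
  exact_mod_cast smul_left_injective ℝ h0 h

theorem eq_zero_of_finrank_lt {k : ℕ} {y : Forms g} (hk : y ∈ formsOfDegree g k)
    (h : finrank ℝ g < k) : y = 0 := by
  have hz : finrank ℝ (formsOfDegree g k) = 0 := by
    rw [exteriorPower.finrank_eq, Subspace.dual_finrank_eq, Nat.choose_eq_zero_of_lt h]
  rw [Submodule.finrank_eq_zero.1 hz] at hk
  exact (Submodule.mem_bot ℝ).1 hk

theorem derivOf_eq_zero_of_trace {T : g →ₗ[ℝ] g} (hT : LinearMap.trace ℝ g T = 0) {y : Forms g}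
    (hy : y ∈ formsOfDegree g (finrank ℝ g)) : derivOf T y = 0 := by
  rw [derivOf_eq_trace_smul T fun θ => eq_zero_of_finrank_lt
    (mul_mem_formsOfDegree (ι_mem_formsOfDegree θ) hy) (by omega), hT, zero_smul]

end ExteriorCalculus

/-! ### Symplectic linear algebra: powers of a nondegenerate 2-form. -/

section Symplectic

variable {g : Type*} [LieRing g] [LieAlgebra ℝ g] [Module.Finite ℝ g] {ω : Forms g}

namespace IsSymplectic

theorem eq_zero_of_contract_eq_zero (hω : IsSymplectic ω) {x : g} (hx : contract x ω = 0) :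
    x = 0 :=
  hω.nondegenerate x fun y => by simp [eval₂, hx]

theorem exists_contract_eq (hω : IsSymplectic ω) (θ : Dual ℝ g) :
    ∃ x : g, contract x ω = ι ℝ θ := by
  have h : ∀ x : g, ι ℝ (ιInv (contract x ω)) = contract x ω := by
    intro x
    obtain ⟨α, hα⟩ := exists_ι_of_mem (contract_mem x hω.mem)
    rw [← hα, ι_leftInverse]
  let F : g →ₗ[ℝ] Dual ℝ g :=
    { toFun := fun x => ιInv (contract x ω)
      map_add' := fun x y => by rw [contract_add, map_add]
      map_smul' := fun c x => by rw [contract_smul, map_smul]; rfl }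
  have hF : Function.Injective F := by
    refine (injective_iff_map_eq_zero F).2 fun x hx => hω.eq_zero_of_contract_eq_zero ?_
    rw [← h x]
    change ι ℝ (F x) = 0
    rw [hx, map_zero]
  obtain ⟨x, hx⟩ := (LinearMap.injective_iff_surjective_of_finrank_eq_finrank
    (Subspace.dual_finrank_eq (K := ℝ) (V := g)).symm).1 hF θ
  exact ⟨x, by rw [← h x]; exact congrArg _ hx⟩

/-- Contract `ω^(k+1) = 0` with the vector that `ω` pairs to `θ`. -/
theorem ι_mul_pow_eq_zero (hω : IsSymplectic ω) {k : ℕ} (h : ω ^ (k + 1) = 0) (θ : Dual ℝ g) :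
    ι ℝ θ * ω ^ k = 0 := by
  obtain ⟨x, hx⟩ := hω.exists_contract_eq θ
  have := contract_pow hω.mem x k
  rw [h, map_zero, hx] at this
  exact (smul_eq_zero_iff_right (by positivity)).1 this.symm

/-- The last nonzero power of `ω` is annihilated by all 1-forms, hence has top degree; this gives
even dimension and a volume form together. -/
theorem exists_finrank_eq (hω : IsSymplectic ω) :
    ∃ n : ℕ, finrank ℝ g = 2 * n ∧ ω ^ n ≠ 0 := by
  classical
  have hex : ∃ k : ℕ, ω ^ (k + 1) = 0 :=
    ⟨finrank ℝ g, eq_zero_of_finrank_lt (hω.pow_mem _) (by omega)⟩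
  have hne : ω ^ Nat.find hex ≠ 0 := by
    rcases hn : Nat.find hex with _ | k
    · simp
    · exact Nat.find_min hex (hn ▸ Nat.lt_succ_self k)
  exact ⟨Nat.find hex, (degree_eq_finrank (hω.pow_mem _) hne
    (hω.ι_mul_pow_eq_zero (Nat.find_spec hex))).symm, hne⟩

/-- Contracting `θ ∧ ω^(n+1) = 0` with `x` expresses `θ(x) ω^(n+1)` through `θ ∧ ω^n`. -/
theorem eq_zero_of_ι_mul_pow (hω : IsSymplectic ω) {n : ℕ} (hn : finrank ℝ g = 2 * (n + 1))
    (h0 : ω ^ (n + 1) ≠ 0) {θ : Dual ℝ g} (h : ω ^ n * ι ℝ θ = 0) : θ = 0 := by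
  ext x
  have h1 : ι ℝ θ * ω ^ (n + 1) = 0 := eq_zero_of_finrank_lt
    (mul_mem_formsOfDegree (ι_mem_formsOfDegree θ) (hω.pow_mem (n + 1))) (by omega)
  have h2 := contract_ι_mul x θ (ω ^ (n + 1))
  obtain ⟨α, hα⟩ := exists_ι_of_mem (contract_mem x hω.mem)
  have h3 : ι ℝ α * ω ^ n = ω ^ n * ι ℝ α := ((commute_of_mem_two hω.mem _).pow_left n).symm
  have h4 : ι ℝ θ * ω ^ n = ω ^ n * ι ℝ θ := ((commute_of_mem_two hω.mem _).pow_left n).symm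
  rw [h1, contract_pow hω.mem, ← hα, mul_smul_comm, ← mul_assoc, ι_anticomm, neg_mul, mul_assoc,
    h4, h, mul_zero, neg_zero, smul_zero, map_zero, sub_zero] at h2
  exact (smul_eq_zero_iff_left h0).1 h2.symm

/-- Injectivity suffices, since 1-forms and forms of codegree 1 have equal dimension. -/
theorem exists_pow_mul_ι_eq (hω : IsSymplectic ω) {n : ℕ} (hn : finrank ℝ g = 2 * (n + 1))
    (h0 : ω ^ (n + 1) ≠ 0) {y : Forms g} (hy : y ∈ formsOfDegree g (2 * n + 1)) :
    ∃ θ : Dual ℝ g, ω ^ n * ι ℝ θ = y := by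
  let F : Dual ℝ g →ₗ[ℝ] formsOfDegree g (2 * n + 1) :=
    (LinearMap.mulLeft ℝ (ω ^ n) ∘ₗ ι ℝ).codRestrict _
      fun θ => hω.pow_mul_mem n (ι_mem_formsOfDegree θ)
  have hF : Function.Injective F := by
    refine (injective_iff_map_eq_zero F).2 fun θ hθ => hω.eq_zero_of_ι_mul_pow hn h0 ?_
    exact congrArg Subtype.val hθ
  have hfin : finrank ℝ (Dual ℝ g) = finrank ℝ (formsOfDegree g (2 * n + 1)) := by
    rw [exteriorPower.finrank_eq, Subspace.dual_finrank_eq, hn,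
      show 2 * (n + 1) = 2 * n + 1 + 1 by ring, Nat.choose_succ_self_right]
  obtain ⟨θ, hθ⟩ := (LinearMap.injective_iff_surjective_of_finrank_eq_finrank hfin).1 hF ⟨y, hy⟩
  exact ⟨θ, congrArg Subtype.val hθ⟩

end IsSymplectic

end Symplectic

/-! ### Forms on almost abelian Lie algebras, and invariance of Lefschetz operators under exact
changes of `ω`. -/

section AlmostAbelianForms

variable {g : Type*} [LieRing g] [LieAlgebra ℝ g]

theorem add_pow_succ_of_sq_eq_zero {R : Type*} [Ring R] [Algebra ℝ R] {a b : R}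
    (hab : Commute a b) (ha : a * a = 0) (n : ℕ) :
    (a + b) ^ (n + 1) = b ^ (n + 1) + (n + 1 : ℝ) • (a * b ^ n) := by
  induction n with
  | zero => simp [add_comm]
  | succ n ih =>
    rw [pow_succ', ih, add_mul, mul_add, mul_add, mul_smul_comm, mul_smul_comm, ← mul_assoc a a,
      ha, zero_mul, smul_zero, add_zero, ← mul_assoc b a, ← hab.eq, mul_assoc a b, ← pow_succ',
      ← pow_succ']
    push_cast
    module

theorem ι_mul_ι_commute (α β : Dual ℝ g) (y : Forms g) :
    Commute (ι ℝ α * ι ℝ β : Forms g) y :=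
  commute_of_mem_two (mul_mem_formsOfDegree (ι_mem_formsOfDegree α) (ι_mem_formsOfDegree β)) y

theorem ι_mul_ι_mul_self (α : Dual ℝ g) (y : Forms g) : ι ℝ α * (ι ℝ α * y) = 0 := by
  rw [← mul_assoc, ι_sq_zero, zero_mul]

theorem ι_mul_ι_mul_ι_mul_ι (α β : Dual ℝ g) :
    (ι ℝ α * ι ℝ β * (ι ℝ α * ι ℝ β) : Forms g) = 0 := by
  rw [mul_assoc, ← mul_assoc (ι ℝ β), ι_anticomm β α, neg_mul, mul_neg, mul_assoc,
    ι_mul_ι_mul_self, neg_zero]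

variable [Module.Finite ℝ g]

theorem sum_smul_ι_coord (θ : Dual ℝ g) :
    ∑ i, θ (finBasis ℝ g i) • (ι ℝ ((finBasis ℝ g).coord i) : Forms g) = ι ℝ θ := by
  simp only [← map_smul, ← map_sum]
  congr 1
  ext x
  have := congrArg θ ((finBasis ℝ g).sum_repr x)
  simp only [map_sum, map_smul] at this
  simp [mul_comm, ← this]

theorem d_mem_coboundaries {k : ℕ} {y : Forms g} (hy : y ∈ formsOfDegree g k) :
    d g y ∈ coboundaries g (k + 1) := ⟨y, hy, rfl⟩

/-- The bracket of `g` is `[x, y] = φ(x) T y - φ(y) T x`, where the linear form `φ` and the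
endomorphism `T` satisfy `φ(f) = 1`, `φ ∘ T = 0` and `T f = 0`. Thus `g` is the semidirect
product of `ℝ f` with the abelian ideal `ker φ`, and `T = ad f`. -/
structure IsAlmostAbelian (φ : Dual ℝ g) (T : g →ₗ[ℝ] g) (f : g) : Prop where
  lie : ∀ x y : g, ⁅x, y⁆ = φ x • T y - φ y • T x
  apply_self : φ f = 1
  comp_eq_zero : φ ∘ₗ T = 0
  map_eq_zero : T f = 0

namespace IsAlmostAbelian

variable {φ : Dual ℝ g} {T : g →ₗ[ℝ] g} {f : g}

theorem dOne_eq (h : IsAlmostAbelian φ T f) (θ : Dual ℝ g) :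
    dOne g θ = -(ι ℝ φ * ι ℝ (θ ∘ₗ T)) := by
  have h2 : ∀ α β : Dual ℝ g, ∑ i, ∑ j, (α (finBasis ℝ g i) * β (finBasis ℝ g j)) •
      (ι ℝ ((finBasis ℝ g).coord i) * ι ℝ ((finBasis ℝ g).coord j) : Forms g)
        = ι ℝ α * ι ℝ β := by
    intro α β
    rw [← sum_smul_ι_coord α, ← sum_smul_ι_coord β, Finset.sum_mul_sum]
    simp only [smul_mul_smul_comm]
  have h3 : dOne g θ = -(1 / 2 : ℝ) • (ι ℝ φ * ι ℝ (θ ∘ₗ T) - ι ℝ (θ ∘ₗ T) * ι ℝ φ) := by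
    rw [dOne_apply, ← h2, ← h2]
    simp only [← Finset.sum_sub_distrib, Finset.smul_sum]
    refine Finset.sum_congr rfl fun i _ => Finset.sum_congr rfl fun j _ => ?_
    rw [h.lie]
    simp only [map_sub, map_smul, smul_eq_mul, LinearMap.comp_apply]
    module
  rw [h3, ι_anticomm (θ ∘ₗ T)]
  module

/-- The formula holds on 1-forms, and multiplying the derivation `derivOf T` by the odd form `φ`
turns its Leibniz rule into the graded one. -/
theorem d_eq (h : IsAlmostAbelian φ T f) (y : Forms g) :
    d g y = -(ι ℝ φ * derivOf T y) := by
  induction y using forms_left_induction with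
  | scalar r =>
    rw [derivOf_algebraMap]
    simp [d, Matrix.algebraMap_eq_diagonal]
  | add a b ha hb => rw [map_add, map_add, ha, hb, mul_add, neg_add]
  | mul θ a ha =>
    rw [d_mul, d_ι, h.dOne_eq, ha, involute_ι, derivOf_mul, derivOf_ι, neg_mul, neg_mul_neg,
      ← mul_assoc, ι_anticomm θ, mul_add, mul_assoc, neg_mul, mul_assoc, neg_add]

theorem derivOf_ι_mul (h : IsAlmostAbelian φ T f) (y : Forms g) :
    derivOf T (ι ℝ φ * y) = ι ℝ φ * derivOf T y := by
  rw [derivOf_mul, derivOf_ι, h.comp_eq_zero, map_zero, zero_mul, zero_add]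

theorem contract_derivOf_self (h : IsAlmostAbelian φ T f) (y : Forms g) :
    contract f (derivOf T y) = derivOf T (contract f y) := by
  rw [contract_derivOf, h.map_eq_zero, contract_zero, add_zero]

theorem derivOf_eq_zero_of_d_eq_zero (h : IsAlmostAbelian φ T f) {y : Forms g}
    (hd : d g y = 0) (hf : derivOf T (contract f y) = 0) : derivOf T y = 0 := by
  rw [h.d_eq, neg_eq_zero] at hd
  exact eq_zero_of_ι_mul_eq_zero h.apply_self hd (by rw [h.contract_derivOf_self, hf])

theorem d_eq_zero_of_derivOf_eq_zero (h : IsAlmostAbelian φ T f) {y : Forms g}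
    (hy : derivOf T y = 0) : d g y = 0 := by
  rw [h.d_eq, hy, mul_zero, neg_zero]

/-- Unimodularity in the form used below: no nonzero top-degree form is exact. -/
theorem d_eq_zero_of_trace (h : IsAlmostAbelian φ T f) (htr : LinearMap.trace ℝ g T = 0) {k : ℕ}
    {y : Forms g} (hy : y ∈ formsOfDegree g k) (hk : k + 1 = finrank ℝ g) : d g y = 0 := by
  rw [h.d_eq, ← h.derivOf_ι_mul, derivOf_eq_zero_of_trace htr, neg_zero]
  have := mul_mem_formsOfDegree (ι_mem_formsOfDegree φ) hy
  rwa [show 1 + k = finrank ℝ g by omega] at this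

/-- A symplectic form is `φ ∧ α + ω₀`, where `ω₀` is a `T`-invariant `2`-form on `ker φ`. -/
theorem exists_eq_add (h : IsAlmostAbelian φ T f) {ω : Forms g} (hω : IsSymplectic ω) :
    ∃ (α : Dual ℝ g) (ω₀ : Forms g), ω = ι ℝ φ * ι ℝ α + ω₀ ∧ α f = 0 ∧
      ω₀ ∈ formsOfDegree g 2 ∧ contract f ω₀ = 0 ∧ derivOf T ω₀ = 0 := by
  obtain ⟨α, hα⟩ := exists_ι_of_mem (contract_mem f hω.mem)
  have hαf : α f = 0 := by
    have := contract_contract f ω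
    rw [← hα, contract_ι] at this
    exact (algebraMap_eq_zero_iff _ _).1 this
  have hφα : (ι ℝ φ * ι ℝ α : Forms g) ∈ formsOfDegree g 2 :=
    mul_mem_formsOfDegree (ι_mem_formsOfDegree φ) (ι_mem_formsOfDegree α)
  have hf : contract f (ω - ι ℝ φ * ι ℝ α) = 0 := by
    rw [map_sub, contract_ι_mul, contract_ι, hαf, h.apply_self, map_zero, mul_zero, one_smul,
      sub_zero, hα, sub_self]
  refine ⟨α, ω - ι ℝ φ * ι ℝ α, by abel, hαf, Submodule.sub_mem _ hω.mem hφα, hf, ?_⟩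
  refine h.derivOf_eq_zero_of_d_eq_zero ?_ (by rw [hf, map_zero])
  rw [map_sub, hω.closed, h.d_eq, h.derivOf_ι_mul, ι_mul_ι_mul_self, neg_zero, sub_zero]

/-- If `g` is unimodular and symplectic, then `T` is not invertible on `ker φ`. -/
theorem not_forall_exists_eq (h : IsAlmostAbelian φ T f) (htr : LinearMap.trace ℝ g T = 0)
    {ω : Forms g} (hω : IsSymplectic ω) :
    ¬ ∀ α : Dual ℝ g, ∃ (β : Dual ℝ g) (c : ℝ), α = β ∘ₗ T + c • φ := by
  intro hT
  obtain ⟨n, hn, h0⟩ := hω.exists_finrank_eq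
  obtain ⟨α, ω₀, rfl, -, hmem, hf, hD⟩ := h.exists_eq_add hω
  have hpos : 0 < finrank ℝ g := by
    refine finrank_pos_iff_exists_ne_zero.2 ⟨f, fun hf0 => ?_⟩
    have := h.apply_self
    rw [hf0, map_zero] at this
    exact zero_ne_one this
  obtain ⟨n, rfl⟩ : ∃ k, n = k + 1 := ⟨n - 1, by omega⟩
  apply h0
  rw [add_pow_succ_of_sq_eq_zero (ι_mul_ι_commute _ _ _) (ι_mul_ι_mul_ι_mul_ι φ α)]
  -- `ω₀` lives on `ker φ`, of dimension `2n + 1`, so its power of degree `2n + 2` vanishes.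
  have h1 : ω₀ ^ (n + 1) = 0 := by
    have hm := pow_mem_formsOfDegree hmem (n + 1)
    refine eq_zero_of_ι_mul_eq_zero h.apply_self (eq_zero_of_finrank_lt
      (mul_mem_formsOfDegree (ι_mem_formsOfDegree φ) hm) (by omega)) ?_
    rw [contract_pow hmem, hf, zero_mul, smul_zero]
  obtain ⟨β, c, rfl⟩ := hT α
  -- The only other term in the expansion of `ω^(n+1)` is `D` of a top-degree form, hence zero.
  have h2 : ι ℝ φ * ι ℝ (β ∘ₗ T + c • φ) * ω₀ ^ n
      = derivOf T (ι ℝ φ * (ι ℝ β * ω₀ ^ n)) := by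
    rw [h.derivOf_ι_mul, derivOf_mul, derivOf_pow T hD, derivOf_ι, mul_zero, add_zero, map_add,
      mul_add, map_smul, mul_smul_comm, ι_sq_zero, smul_zero, add_zero, mul_assoc]
  rw [h1, h2, zero_add, derivOf_eq_zero_of_trace htr, smul_zero]
  have := mul_mem_formsOfDegree (ι_mem_formsOfDegree φ)
    (mul_mem_formsOfDegree (ι_mem_formsOfDegree β) (pow_mem_formsOfDegree hmem n))
  rwa [show 1 + (1 + 2 * n) = finrank ℝ g by omega] at this

end IsAlmostAbelian

/-- If `i_x ω = 0`, then `i_x` kills `ω^n`; contracting `θ ∧ ω^n = 0` leaves `θ(x) ω^n = 0` for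
every `θ`. -/
theorem isSymplectic_of_pow_ne_zero {ω : Forms g} {n : ℕ} (hmem : ω ∈ formsOfDegree g 2)
    (hd : d g ω = 0) (hn : finrank ℝ g = 2 * n) (h0 : ω ^ n ≠ 0) : IsSymplectic ω := by
  refine ⟨hmem, hd, fun x hx => ?_⟩
  have hxω : contract x ω = 0 := by
    obtain ⟨α, hα⟩ := exists_ι_of_mem (contract_mem x hmem)
    have : α = 0 := by
      ext y
      have := hx y
      rwa [eval₂, ← hα, contract_ι, algebraMap_leftInverse _ _] at this
    rw [← hα, this, map_zero]
  have hpow : contract x (ω ^ n) = 0 := by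
    rcases n with _ | n
    · simpa using contract_algebraMap x (1 : ℝ)
    · rw [contract_pow hmem, hxω, zero_mul, smul_zero]
  refine (Module.forall_dual_apply_eq_zero_iff ℝ x).1 fun θ => ?_
  have h1 : ι ℝ θ * ω ^ n = 0 := eq_zero_of_finrank_lt
    (mul_mem_formsOfDegree (ι_mem_formsOfDegree θ) (pow_mem_formsOfDegree hmem n)) (by omega)
  have h2 := contract_ι_mul x θ (ω ^ n)
  rw [h1, hpow, map_zero, mul_zero, sub_zero] at h2
  exact (smul_eq_zero_iff_left h0).1 h2.symm

namespace IsSymplectic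

variable {ω ω' : Forms g}

theorem pow_mul_sub_mem_coboundaries (hω : IsSymplectic ω) (hω' : IsSymplectic ω')
    {β : Dual ℝ g} (hβ : ω - ω' = d g (ι ℝ β)) (r : ℕ) {k : ℕ} {η : Forms g}
    (hη : η ∈ cocycles g k) : ω ^ r * η - ω' ^ r * η ∈ coboundaries g (2 * r + k) := by
  induction r with
  | zero => simp
  | succ r ih =>
    -- Telescoping: replace one factor `ω` by `ω'`, at the cost of `dβ ∧ ω'^r ∧ η`, which is exact
    -- because `ω'^r ∧ η` is closed.
    have h1 : ω ^ (r + 1) * η - ω' ^ (r + 1) * η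
        = ω ^ 1 * (ω ^ r * η - ω' ^ r * η) + d g (ι ℝ β * (ω' ^ r * η)) := by
      have hcl : d g (ω' ^ r * η) = 0 := (hω'.pow_mul_mem_cocycles r k η hη).2
      rw [d_mul, hcl, mul_zero, add_zero, ← hβ, pow_one, pow_succ', pow_succ', sub_mul, mul_sub]
      simp only [mul_assoc]
      abel
    rw [h1]
    refine Submodule.add_mem _ ?_ ?_
    · rw [show 2 * (r + 1) + k = 2 * 1 + (2 * r + k) by ring]
      exact hω.pow_mul_mem_coboundaries 1 _ _ ih
    · rw [show 2 * (r + 1) + k = 1 + (2 * r + k) + 1 by ring]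
      exact d_mem_coboundaries
        (mul_mem_formsOfDegree (ι_mem_formsOfDegree β) (hω'.pow_mul_mem r hη.1))

/-- Cohomologous symplectic forms have the same Lefschetz operators. -/
theorem wedgePow_eq (hω : IsSymplectic ω) (hω' : IsSymplectic ω')
    {β : Dual ℝ g} (hβ : ω - ω' = d g (ι ℝ β)) (r k : ℕ) : hω.wedgePow r k = hω'.wedgePow r k := by
  refine Submodule.linearMap_qext _ (LinearMap.ext fun η => ?_)
  exact (Submodule.Quotient.eq _).2 (hω.pow_mul_sub_mem_coboundaries hω' hβ r η.2)

theorem wedgePow_injective (hω : IsSymplectic ω) {r k : ℕ}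
    (h : ∀ η ∈ cocycles g k, ω ^ r * η ∈ coboundaries g (2 * r + k) → η ∈ coboundaries g k) :
    Function.Injective (hω.wedgePow r k) := by
  refine (injective_iff_map_eq_zero _).2 fun x => ?_
  obtain ⟨η, rfl⟩ := Submodule.Quotient.mk_surjective _ x
  intro hx
  exact (Submodule.Quotient.mk_eq_zero _).2
    (h η.1 η.2 ((Submodule.Quotient.mk_eq_zero
      ((coboundaries g (2 * r + k)).submoduleOf (cocycles g (2 * r + k)))).1 hx))

theorem wedgePow_surjective (hω : IsSymplectic ω) {r k : ℕ}
    (h : ∀ y ∈ cocycles g (2 * r + k), ∃ η ∈ cocycles g k,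
      ω ^ r * η - y ∈ coboundaries g (2 * r + k)) :
    Function.Surjective (hω.wedgePow r k) := by
  intro x
  obtain ⟨y, rfl⟩ := Submodule.Quotient.mk_surjective _ x
  obtain ⟨η, hη, hy⟩ := h y.1 y.2
  exact ⟨Submodule.Quotient.mk ⟨η, hη⟩, (Submodule.Quotient.eq _).2 hy⟩

theorem ker_wedgePow_ne_bot (hω : IsSymplectic ω) {r k : ℕ} {η : Forms g} (hη : η ∈ cocycles g k)
    (hne : η ∉ coboundaries g k) (h : ω ^ r * η ∈ coboundaries g (2 * r + k)) :
    LinearMap.ker (hω.wedgePow r k) ≠ ⊥ := by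
  intro hker
  have hmem : (Submodule.Quotient.mk ⟨η, hη⟩ : Cohomology g k)
      ∈ LinearMap.ker (hω.wedgePow r k) :=
    LinearMap.mem_ker.2 ((Submodule.Quotient.mk_eq_zero _).2 h)
  rw [hker, Submodule.mem_bot] at hmem
  exact hne ((Submodule.Quotient.mk_eq_zero
    ((coboundaries g k).submoduleOf (cocycles g k))).1 hmem)

end IsSymplectic

end AlmostAbelianForms

/-! ### The case `ker T = ⟨f, e⟩`: normal form of `ω` and the Lefschetz operators in degrees 1 and
2. -/

section Split

variable {g : Type*} [LieRing g] [LieAlgebra ℝ g]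

/-- An almost abelian Lie algebra such that the kernel of `T = ad f` is spanned by `f` and `e`
and has the invariant complement `ker φ ⊓ ker ε`, the image of `T`. -/
structure IsSplitAlmostAbelian (φ ε : Dual ℝ g) (T : g →ₗ[ℝ] g) (f e : g) : Prop
    extends IsAlmostAbelian φ T f where
  fst_apply : φ e = 0
  snd_apply_fst : ε f = 0
  snd_apply : ε e = 1
  snd_comp_eq_zero : ε ∘ₗ T = 0
  map_snd_eq_zero : T e = 0
  eq_of_map_eq_zero : ∀ x, T x = 0 → x = φ x • f + ε x • e
  exists_eq_add_map : ∀ x, ∃ y, x = φ x • f + ε x • e + T y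

namespace IsSplitAlmostAbelian

variable {φ ε : Dual ℝ g} {T : g →ₗ[ℝ] g} {f e : g}

theorem eq_of_comp_eq_zero (h : IsSplitAlmostAbelian φ ε T f e) {θ : Dual ℝ g}
    (hθ : θ ∘ₗ T = 0) : θ = θ f • φ + θ e • ε := by
  ext x
  obtain ⟨y, hy⟩ := h.exists_eq_add_map x
  have h0 : θ (T y) = 0 := LinearMap.congr_fun hθ y
  conv_lhs => rw [hy]
  simp [h0, mul_comm]

/-- The range of the transpose of `T` is the annihilator of `ker T`; multiples of `φ` and `ε` can be
subtracted from a preimage because both vanish on `im T`. -/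
theorem exists_eq_comp (h : IsSplitAlmostAbelian φ ε T f e) {θ : Dual ℝ g} (hf : θ f = 0)
    (he : θ e = 0) : ∃ β : Dual ℝ g, θ = β ∘ₗ T ∧ β f = 0 ∧ β e = 0 := by
  have hmem : θ ∈ LinearMap.range T.dualMap := by
    rw [LinearMap.range_dualMap_eq_dualAnnihilator_ker, Submodule.mem_dualAnnihilator]
    intro x hx
    rw [h.eq_of_map_eq_zero x hx]
    simp [hf, he]
  obtain ⟨β, rfl⟩ := hmem
  refine ⟨β - β f • φ - β e • ε, ?_, ?_, ?_⟩
  · rw [LinearMap.sub_comp, LinearMap.sub_comp, LinearMap.smul_comp, LinearMap.smul_comp,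
      h.comp_eq_zero, h.snd_comp_eq_zero, smul_zero, smul_zero, sub_zero, sub_zero]
    rfl
  · simp [h.apply_self, h.snd_apply_fst]
  · simp [h.fst_apply, h.snd_apply]

theorem ι_mul_ι_mul_eq_zero (h : IsSplitAlmostAbelian φ ε T f e) {y : Forms g}
    (hf : contract f y = 0) (he : contract e y = 0) (hy : ι ℝ φ * (ι ℝ ε * y) = 0) : y = 0 := by
  refine eq_zero_of_ι_mul_eq_zero h.snd_apply (eq_zero_of_ι_mul_eq_zero h.apply_self hy ?_) he
  rw [contract_ι_mul, h.snd_apply_fst, hf, zero_smul, mul_zero, sub_zero]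

variable [Module.Finite ℝ g]

theorem eq_zero_of_finrank_lt (h : IsSplitAlmostAbelian φ ε T f e) {y : Forms g}
    (hf : contract f y = 0) (he : contract e y = 0) {k : ℕ} (hk : y ∈ formsOfDegree g k)
    (hlt : finrank ℝ g < k + 2) : y = 0 :=
  h.ι_mul_ι_mul_eq_zero hf he (LieForms.eq_zero_of_finrank_lt
    (mul_mem_formsOfDegree (ι_mem_formsOfDegree φ)
      (mul_mem_formsOfDegree (ι_mem_formsOfDegree ε) hk)) (by omega))

theorem derivOf_snd_mul (h : IsSplitAlmostAbelian φ ε T f e) (y : Forms g) :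
    derivOf T (ι ℝ ε * y) = ι ℝ ε * derivOf T y := by
  rw [derivOf_mul, derivOf_ι, h.snd_comp_eq_zero, map_zero, zero_mul, zero_add]

theorem contract_snd_derivOf (h : IsSplitAlmostAbelian φ ε T f e) (y : Forms g) :
    contract e (derivOf T y) = derivOf T (contract e y) := by
  rw [contract_derivOf, h.map_snd_eq_zero, contract_zero, add_zero]

/-- `φ ∧ ε ∧ y` has at least top degree and `D` commutes with multiplication by `φ` and `ε`, so `φ ∧
ε ∧ D y = 0`; `D y` has no component along `φ` or `ε`. -/
theorem derivOf_eq_zero_of_finrank_le (h : IsSplitAlmostAbelian φ ε T f e)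
    (htr : LinearMap.trace ℝ g T = 0) {y : Forms g}
    (hf : contract f y = 0) (he : contract e y = 0) {k : ℕ} (hk : y ∈ formsOfDegree g k)
    (hle : finrank ℝ g ≤ k + 2) : derivOf T y = 0 := by
  have hm := mul_mem_formsOfDegree (ι_mem_formsOfDegree φ)
    (mul_mem_formsOfDegree (ι_mem_formsOfDegree ε) hk)
  refine h.ι_mul_ι_mul_eq_zero (by rw [h.contract_derivOf_self, hf, map_zero])
    (by rw [h.contract_snd_derivOf, he, map_zero]) ?_
  rw [← h.derivOf_snd_mul, ← h.derivOf_ι_mul]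
  rcases hle.lt_or_eq with hlt | heq
  · rw [LieForms.eq_zero_of_finrank_lt hm (by omega), map_zero]
  · refine derivOf_eq_zero_of_trace htr ?_
    rwa [show 1 + (1 + k) = finrank ℝ g by omega] at hm

end IsSplitAlmostAbelian

variable [Module.Finite ℝ g]

/-- A symplectic form `c φ ∧ ε + ω₀`, where `ω₀` is a `T`-invariant `2`-form on the image
of `T`. -/
structure IsNormalForm (φ ε : Dual ℝ g) (T : g →ₗ[ℝ] g) (f e : g) (c : ℝ) (ω₀ ω : Forms g) :
    Prop where
  eq_add : ω = c • (ι ℝ φ * ι ℝ ε) + ω₀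
  mem : ω₀ ∈ formsOfDegree g 2
  contract_fst : contract f ω₀ = 0
  contract_snd : contract e ω₀ = 0
  derivOf_eq_zero : derivOf T ω₀ = 0

namespace IsSplitAlmostAbelian

variable {φ ε : Dual ℝ g} {T : g →ₗ[ℝ] g} {f e : g} {c : ℝ} {ω₀ ω : Forms g}

theorem exists_isNormalForm (h : IsSplitAlmostAbelian φ ε T f e)
    (htr : LinearMap.trace ℝ g T = 0) (hω : IsSymplectic ω) :
    ∃ (c : ℝ) (ω₀ ω' : Forms g) (β : Dual ℝ g), IsNormalForm φ ε T f e c ω₀ ω' ∧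
      IsSymplectic ω' ∧ ω - ω' = d g (ι ℝ β) := by
  obtain ⟨n, hn, h0⟩ := hω.exists_finrank_eq
  obtain ⟨α, ω₀, hadd, hαf, hmem, hf, hD⟩ := h.exists_eq_add hω
  -- Invariance of `ω₀` and `T e = 0` make `γ = i_e ω₀` vanish on `im T`; it also vanishes on `f`
  -- and `e`.
  have he : contract e ω₀ = 0 := by
    obtain ⟨γ, hγ⟩ := exists_ι_of_mem (contract_mem e hmem)
    have h1 : γ ∘ₗ T = 0 := by
      have := h.contract_snd_derivOf ω₀
      rw [hD, map_zero, ← hγ, derivOf_ι, eq_comm, ι_eq_zero_iff] at this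
      exact this
    have h2 : γ e = 0 := by
      have := contract_contract e ω₀
      rw [← hγ, contract_ι] at this
      exact (algebraMap_eq_zero_iff _ _).1 this
    have h3 : γ f = 0 := by
      have := contract_comm f e ω₀
      rw [← hγ, hf, map_zero, neg_zero, contract_ι] at this
      exact (algebraMap_eq_zero_iff _ _).1 this
    rw [← hγ, h.eq_of_comp_eq_zero h1, h2, h3]
    simp
  obtain ⟨β, hβ, -, -⟩ := h.exists_eq_comp (θ := α - α e • ε)
    (by simp [hαf, h.snd_apply_fst]) (by simp [h.snd_apply])
  set ω' := α e • (ι ℝ φ * ι ℝ ε) + ω₀ with hω'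
  have hsub : ω - ω' = d g (ι ℝ (-β)) := by
    rw [h.d_eq, derivOf_ι, LinearMap.neg_comp, ← hβ, hadd, hω']
    simp [mul_sub]
  have hN : IsNormalForm φ ε T f e (α e) ω₀ ω' := ⟨rfl, hmem, hf, he, hD⟩
  have hmem' : ω' ∈ formsOfDegree g 2 :=
    Submodule.add_mem _ (Submodule.smul_mem _ _
      (mul_mem_formsOfDegree (ι_mem_formsOfDegree φ) (ι_mem_formsOfDegree ε))) hmem
  have hd' : d g ω' = 0 := by
    rw [eq_sub_of_add_eq' (sub_add_cancel ω ω'), map_sub, hω.closed, hsub, d_d, sub_zero]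
  refine ⟨α e, ω₀, ω', -β, hN, isSymplectic_of_pow_ne_zero hmem' hd' hn fun h0' => h0 ?_, hsub⟩
  -- For nondegeneracy of `ω'`: its powers differ from those of `ω` by exact forms, and an exact
  -- top-degree form is zero.
  have key : ∀ r : ℕ, ∃ y ∈ formsOfDegree g (2 * r + 1),
      ω ^ (r + 1) - ω' ^ (r + 1) = d g y := by
    intro r
    induction r with
    | zero => exact ⟨_, ι_mem_formsOfDegree (-β), by rw [zero_add, pow_one, pow_one]; exact hsub⟩
    | succ r ih =>
      obtain ⟨y, hy, hyd⟩ := ih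
      have hcl : d g (ω' ^ (r + 1)) = 0 := by
        rw [h.d_eq, derivOf_pow, mul_zero, neg_zero]
        rw [hω', map_add, map_smul, derivOf_mul, derivOf_ι, derivOf_ι, h.comp_eq_zero,
          h.snd_comp_eq_zero, hD]
        simp
      refine ⟨ω * y + ι ℝ (-β) * ω' ^ (r + 1), Submodule.add_mem _ ?_ ?_, ?_⟩
      · have := mul_mem_formsOfDegree hω.mem hy
        rwa [show 2 + (2 * r + 1) = 2 * (r + 1) + 1 by ring] at this
      · have := mul_mem_formsOfDegree (ι_mem_formsOfDegree (-β))
          (pow_mem_formsOfDegree hmem' (r + 1))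
        rwa [show 1 + 2 * (r + 1) = 2 * (r + 1) + 1 by ring] at this
      · rw [map_add, d_mul, d_mul, hω.closed, hcl, ← hyd, ← hsub, involute_of_mem_two hω.mem,
          pow_succ' ω, pow_succ' ω']
        noncomm_ring
  rcases n with _ | n
  · simp at h0'
  · obtain ⟨y, hy, hyd⟩ := key n
    rwa [h0', h.d_eq_zero_of_trace htr hy (by omega), sub_zero] at hyd

end IsSplitAlmostAbelian

namespace IsNormalForm

variable {φ ε : Dual ℝ g} {T : g →ₗ[ℝ] g} {f e : g} {c : ℝ} {ω₀ ω : Forms g}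

theorem derivOf_form (hN : IsNormalForm φ ε T f e c ω₀ ω) (h : IsSplitAlmostAbelian φ ε T f e) :
    derivOf T ω = 0 := by
  rw [hN.eq_add, map_add, map_smul, derivOf_mul, derivOf_ι, derivOf_ι, h.comp_eq_zero,
    h.snd_comp_eq_zero, hN.derivOf_eq_zero]
  simp

theorem ι_mul_pow (hN : IsNormalForm φ ε T f e c ω₀ ω) (r : ℕ) :
    ι ℝ φ * ω ^ r = ι ℝ φ * ω₀ ^ r := by
  induction r with
  | zero => simp
  | succ r ih =>
    have h1 : ι ℝ φ * ω = ι ℝ φ * ω₀ := by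
      rw [hN.eq_add, mul_add, mul_smul_comm, ι_mul_ι_mul_self, smul_zero, zero_add]
    rw [pow_succ, ← mul_assoc, ih, mul_assoc, ← ((commute_of_mem_two hN.mem ω).pow_left r).symm.eq,
      ← mul_assoc, h1, mul_assoc, ← pow_succ']

theorem contract_pow_mul (hN : IsNormalForm φ ε T f e c ω₀ ω) {ζ : Forms g}
    (hf : contract f ζ = 0) (he : contract e ζ = 0) (r : ℕ) :
    contract f (ω₀ ^ r * ζ) = 0 ∧ contract e (ω₀ ^ r * ζ) = 0 := by
  induction r with
  | zero => simp [hf, he]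
  | succ r ih =>
    rw [pow_succ', mul_assoc, contract_mul, ih.1, contract_mul, ih.2, hN.contract_fst,
      hN.contract_snd]
    simp

theorem ι_mul_ι_mul_pow_ne_zero (hN : IsNormalForm φ ε T f e c ω₀ ω)
    (h : IsSplitAlmostAbelian φ ε T f e) {n : ℕ} (hn : finrank ℝ g = 2 * (n + 1))
    (h0 : ω ^ (n + 1) ≠ 0) : ω ^ n * (ι ℝ φ * ι ℝ ε) ≠ 0 := by
  intro hz
  apply h0
  have hp : ω₀ ^ (n + 1) = 0 := by
    have := hN.contract_pow_mul (ζ := 1) (by simpa using contract_algebraMap f (1 : ℝ))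
      (by simpa using contract_algebraMap e (1 : ℝ)) (n + 1)
    rw [mul_one] at this
    exact h.eq_zero_of_finrank_lt this.1 this.2 (pow_mem_formsOfDegree hN.mem _) (by omega)
  have hφε : ω ^ n * (ι ℝ φ * ι ℝ ε) = ι ℝ φ * ι ℝ ε * ω₀ ^ n := by
    rw [← (ι_mul_ι_commute φ ε _).eq, ι_anticomm φ ε, neg_mul, mul_assoc, hN.ι_mul_pow, neg_mul,
      mul_assoc]
  rw [hN.eq_add, add_pow_succ_of_sq_eq_zero ((ι_mul_ι_commute φ ε ω₀).smul_left c)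
    (by rw [smul_mul_smul_comm, ι_mul_ι_mul_ι_mul_ι, smul_zero]), hp, zero_add, smul_mul_assoc,
    ← hφε, hz, smul_zero, smul_zero]

/-- If `ζ` is a form on the image of `T` of large enough degree, then `ω^r ∧ Tζ` is exact. -/
theorem pow_mul_derivOf_mem_coboundaries (hN : IsNormalForm φ ε T f e c ω₀ ω)
    (h : IsSplitAlmostAbelian φ ε T f e) (htr : LinearMap.trace ℝ g T = 0)
    (hω : IsSymplectic ω) {ζ : Forms g} (hf : contract f ζ = 0) (he : contract e ζ = 0)
    {k : ℕ} (hk : ζ ∈ formsOfDegree g (k + 1)) {r : ℕ} (hle : finrank ℝ g ≤ 2 * r + (k + 1) + 2) :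
    ω ^ r * derivOf T ζ ∈ coboundaries g (2 * r + (k + 1)) := by
  have hp := hN.contract_pow_mul hf he r
  -- Contract `φ ∧ ω^r ∧ ζ = φ ∧ ω₀^r ∧ ζ` with `f`. Under `D` the second summand dies for degree
  -- reasons, and the first becomes `d` of `-i_f (ω^r ∧ ζ)`.
  have h1 : ω ^ r * ζ = ι ℝ φ * contract f (ω ^ r * ζ) + ω₀ ^ r * ζ := by
    rw [← sub_eq_zero, ← sub_sub]
    have h2 := contract_ι_mul f φ (ω ^ r * ζ)
    rw [← mul_assoc, hN.ι_mul_pow, mul_assoc, contract_ι_mul, h.apply_self, hp.1, mul_zero,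
      sub_zero, one_smul, one_smul] at h2
    rw [h2, sub_self]
  have h2 : ω ^ r * derivOf T ζ = d g (-contract f (ω ^ r * ζ)) := by
    have h3 : ω ^ r * derivOf T ζ = derivOf T (ω ^ r * ζ) := by
      rw [derivOf_mul, derivOf_pow T (hN.derivOf_form h), zero_mul, zero_add]
    rw [h3, h1, map_add, h.derivOf_ι_mul, ← h1, map_neg, h.d_eq, neg_neg,
      h.derivOf_eq_zero_of_finrank_le htr hp.1 hp.2
        (mul_mem_formsOfDegree (pow_mem_formsOfDegree hN.mem r) hk) hle, add_zero]
  rw [h2]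
  exact d_mem_coboundaries (Submodule.neg_mem _ (contract_mem f (hω.pow_mul_mem r hk)))

theorem bijective_wedgePow_one (hN : IsNormalForm φ ε T f e c ω₀ ω)
    (h : IsSplitAlmostAbelian φ ε T f e) (htr : LinearMap.trace ℝ g T = 0)
    (hω : IsSymplectic ω) {n : ℕ} (hn : finrank ℝ g = 2 * (n + 1)) (h0 : ω ^ (n + 1) ≠ 0) :
    Function.Bijective (hω.wedgePow n 1) := by
  constructor
  · refine hω.wedgePow_injective ?_
    rintro η ⟨hη, hd⟩ ⟨y, hy, hyd⟩
    obtain ⟨θ, rfl⟩ := exists_ι_of_mem hη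
    have hD := h.derivOf_eq_zero_of_d_eq_zero hd (by rw [contract_ι, derivOf_algebraMap])
    rw [derivOf_ι, ι_eq_zero_iff] at hD
    have hne := hN.ι_mul_ι_mul_pow_ne_zero h hn h0
    -- With `ω^n ∧ θ = dy` and `ρ ∘ T = 0`, the product `dy ∧ ρ` is `-D (φ ∧ y ∧ ρ)`, `D` of a
    -- top-degree form. Taking `ρ = ε` and `ρ = φ` isolates the two coefficients of `θ`.
    have hpair : ∀ ρ : Dual ℝ g, ρ ∘ₗ T = 0 → ω ^ n * (ι ℝ θ * ι ℝ ρ) = 0 := by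
      intro ρ hρ
      have h1 : derivOf T (ι ℝ φ * (y * ι ℝ ρ)) = 0 := by
        refine derivOf_eq_zero_of_trace htr ?_
        have := mul_mem_formsOfDegree (ι_mem_formsOfDegree φ)
          (mul_mem_formsOfDegree hy (ι_mem_formsOfDegree ρ))
        rwa [show 1 + (2 * n + 0 + 1) = finrank ℝ g by omega] at this
      rw [h.derivOf_ι_mul, derivOf_mul, derivOf_ι, hρ, map_zero, mul_zero, add_zero] at h1
      rw [← mul_assoc, ← hyd, h.d_eq, neg_mul, mul_assoc, h1, neg_zero]
    have hθ := h.eq_of_comp_eq_zero hD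
    have hf : θ f = 0 := by
      have := hpair ε h.snd_comp_eq_zero
      rw [hθ, map_add, map_smul, map_smul, add_mul, smul_mul_assoc, smul_mul_assoc, ι_sq_zero,
        smul_zero, add_zero, mul_smul_comm] at this
      exact (smul_eq_zero_iff_left hne).1 this
    have he : θ e = 0 := by
      have := hpair φ h.comp_eq_zero
      rw [hθ, map_add, map_smul, map_smul, add_mul, smul_mul_assoc, smul_mul_assoc, ι_sq_zero,
        smul_zero, zero_add, ι_anticomm, smul_neg, mul_neg, mul_smul_comm, neg_eq_zero] at this
      exact (smul_eq_zero_iff_left hne).1 this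
    rw [hθ, hf, he]
    simp
  · refine hω.wedgePow_surjective ?_
    rintro y ⟨hy, -⟩
    -- Split `θ` into a closed part in the span of `φ`, `ε` and a part `β ∘ T = D β`, whose product
    -- with `ω^n` is exact.
    obtain ⟨θ, rfl⟩ := hω.exists_pow_mul_ι_eq hn h0 hy
    obtain ⟨β, hβ, hβf, hβe⟩ := h.exists_eq_comp (θ := θ - θ f • φ - θ e • ε)
      (by simp [h.apply_self, h.snd_apply_fst]) (by simp [h.fst_apply, h.snd_apply])
    refine ⟨ι ℝ (θ f • φ + θ e • ε), ⟨ι_mem_formsOfDegree _, ?_⟩, ?_⟩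
    · refine h.d_eq_zero_of_derivOf_eq_zero ?_
      rw [derivOf_ι, LinearMap.add_comp, LinearMap.smul_comp, LinearMap.smul_comp, h.comp_eq_zero,
        h.snd_comp_eq_zero]
      simp
    · have h1 : ω ^ n * ι ℝ (θ f • φ + θ e • ε) - ω ^ n * ι ℝ θ
          = -(ω ^ n * derivOf T (ι ℝ β)) := by
        rw [derivOf_ι, ← hβ, ← mul_sub, ← map_sub, ← mul_neg, ← map_neg]
        congr 2
        abel
      rw [h1]
      exact Submodule.neg_mem _ (hN.pow_mul_derivOf_mem_coboundaries h htr hω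
        (by rw [contract_ι, hβf, map_zero]) (by rw [contract_ι, hβe, map_zero])
        (ι_mem_formsOfDegree β) (by omega))

theorem ker_wedgePow_two_ne_bot (hN : IsNormalForm φ ε T f e c ω₀ ω)
    (h : IsSplitAlmostAbelian φ ε T f e) (htr : LinearMap.trace ℝ g T = 0)
    (hω : IsSymplectic ω) {n : ℕ} (hn : finrank ℝ g = 2 * (n + 2)) {lam : ℝ} (hlam : lam ≠ 0)
    {u : g} (hu : u ≠ 0) (hTu : T u = lam • u) {χ θ : Dual ℝ g} (hθ0 : θ ≠ 0)
    (hχ : χ ∘ₗ T = lam • χ + θ) (hθ : θ ∘ₗ T = lam • θ) :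
    LinearMap.ker (hω.wedgePow n 2) ≠ ⊥ := by
  -- Since their eigenvalues are nonzero, `θ`, `χ` and `ψ` all vanish on `ker T`, so they are forms
  -- on `im T`.
  have hzero : ∀ {ρ : Dual ℝ g} {x : g} {t : ℝ}, t ≠ 0 → ρ (T x) = t * ρ x → T x = 0 → ρ x = 0 := by
    intro ρ x t ht h1 h2
    rw [h2, map_zero, eq_comm] at h1
    exact (mul_eq_zero.1 h1).resolve_left ht
  have hθx : ∀ x, T x = 0 → θ x = 0 := fun x hx =>
    hzero hlam (LinearMap.congr_fun hθ x) hx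
  have hχx : ∀ x, T x = 0 → χ x = 0 := fun x hx =>
    hzero hlam (by simpa [hθx x hx] using LinearMap.congr_fun hχ x) hx
  have hker : ∀ ρ : Dual ℝ g, ρ ∘ₗ T = 0 → ρ u = 0 := by
    intro ρ hρ
    have := LinearMap.congr_fun hρ u
    simpa [hTu, hlam] using this
  obtain ⟨ψ, hψ⟩ := exists_ι_of_mem (contract_mem u hN.mem)
  have hψ0 : ψ ≠ 0 := by
    rintro rfl
    refine hu (hω.eq_zero_of_contract_eq_zero ?_)
    rw [hN.eq_add, map_add, ← hψ, map_smul, contract_ι_mul, contract_ι, hker φ h.comp_eq_zero,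
      hker ε h.snd_comp_eq_zero]
    simp
  -- Contract `D ω₀ = 0` with the eigenvector `u`.
  have hψT : ψ ∘ₗ T = -lam • ψ := by
    have := contract_derivOf T u ω₀
    rw [hN.derivOf_eq_zero, map_zero, hTu, contract_smul, ← hψ, derivOf_ι, ← map_smul,
      ← map_add, eq_comm, ι_eq_zero_iff] at this
    ext x
    have := LinearMap.congr_fun this x
    simp only [LinearMap.add_apply, LinearMap.smul_apply, LinearMap.zero_apply, smul_eq_mul]
      at this ⊢
    linarith
  have hψx : ∀ x, T x = 0 → ψ x = 0 := fun x hx =>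
    hzero (neg_ne_zero.2 hlam) (LinearMap.congr_fun hψT x) hx
  have hcontr : ∀ (α : Dual ℝ g) (x : g), α x = 0 → ψ x = 0 →
      contract x (ι ℝ α * ι ℝ ψ) = 0 := by
    intro α x h1 h2
    rw [contract_ι_mul, contract_ι, h1, h2]
    simp
  have hD : derivOf T (ι ℝ χ * ι ℝ ψ) = ι ℝ θ * ι ℝ ψ := by
    rw [derivOf_mul, derivOf_ι, derivOf_ι, hχ, hψT, map_add, map_smul, map_smul, add_mul,
      smul_mul_assoc, mul_smul_comm]
    module
  have hD2 : derivOf T (ι ℝ θ * ι ℝ ψ) = 0 := by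
    rw [derivOf_mul, derivOf_ι, derivOf_ι, hθ, hψT, map_smul, map_smul,
      smul_mul_assoc, mul_smul_comm]
    module
  -- Otherwise `θ` and `ψ` would be proportional, though their eigenvalues `lam` and `-lam` differ.
  have hne : (ι ℝ θ * ι ℝ ψ : Forms g) ≠ 0 := by
    intro hz
    obtain ⟨x, hx⟩ : ∃ x, θ x ≠ 0 := by
      by_contra! hx
      exact hθ0 (LinearMap.ext hx)
    have h1 : θ x • ψ = ψ x • θ := by
      have := contract_ι_mul x θ (ι ℝ ψ : Forms g)
      rw [hz, map_zero, contract_ι, ← Algebra.commutes, ← Algebra.smul_def, ← map_smul,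
        ← map_smul, ← map_sub, eq_comm, ι_eq_zero_iff, sub_eq_zero] at this
      exact this
    refine hψ0 (LinearMap.ext fun z => ?_)
    have h2 := LinearMap.congr_fun h1 z
    have h3 := LinearMap.congr_fun h1 (T z)
    have h4 := LinearMap.congr_fun hψT z
    have h5 := LinearMap.congr_fun hθ z
    simp only [LinearMap.comp_apply, LinearMap.smul_apply, smul_eq_mul] at h2 h3 h4 h5
    rw [h4, h5] at h3
    have h6 : (2 * lam * θ x) * ψ z = 0 := by linear_combination lam * h2 - h3
    exact (mul_eq_zero.1 h6).resolve_left (mul_ne_zero (mul_ne_zero two_ne_zero hlam) hx)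
  have hmem : ∀ α : Dual ℝ g, (ι ℝ α * ι ℝ ψ : Forms g) ∈ formsOfDegree g 2 := fun α =>
    mul_mem_formsOfDegree (ι_mem_formsOfDegree α) (ι_mem_formsOfDegree ψ)
  refine hω.ker_wedgePow_ne_bot (η := ι ℝ θ * ι ℝ ψ)
    ⟨hmem θ, h.d_eq_zero_of_derivOf_eq_zero hD2⟩ ?_ ?_
  -- An exact form is killed by `φ ∧`; being also killed by `i_f`, `θ ∧ ψ` would vanish.
  · rintro ⟨y, -, hy⟩
    refine hne (eq_zero_of_ι_mul_eq_zero h.apply_self ?_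
      (hcontr θ f (hθx f h.map_eq_zero) (hψx f h.map_eq_zero)))
    rw [← hy, h.d_eq, mul_neg, ι_mul_ι_mul_self, neg_zero]
  · rw [← hD]
    exact hN.pow_mul_derivOf_mem_coboundaries h htr hω
      (hcontr χ f (hχx f h.map_eq_zero) (hψx f h.map_eq_zero))
      (hcontr χ e (hχx e h.map_snd_eq_zero) (hψx e h.map_snd_eq_zero)) (hmem χ) (by omega)

end IsNormalForm

end Split

/-! ### Jordan chains of non-semisimple endomorphisms with real eigenvalues. -/

section LinearAlgebra

open Polynomial

theorem exists_sq_dvd_of_not_squarefree {p : ℝ[X]} (hp : p ≠ 0) (hs : p.Splits)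
    (hsq : ¬ Squarefree p) : ∃ lam : ℝ, (X - C lam) * (X - C lam) ∣ p := by
  rw [Squarefree] at hsq
  push Not at hsq
  obtain ⟨q, hq, hu⟩ := hsq
  have hqp : q ∣ p := (Dvd.intro _ rfl).trans hq
  have hq0 : q ≠ 0 := ne_zero_of_dvd_ne_zero hp hqp
  obtain ⟨lam, hlam⟩ := (hs.of_dvd hp hqp).exists_eval_eq_zero
    fun h => hu (isUnit_iff_degree_eq_zero.2 h)
  have := dvd_iff_isRoot.2 hlam
  exact ⟨lam, (mul_dvd_mul this this).trans hq⟩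

/-- If `B` were semisimple, then `N = B - S`, a difference of commuting semisimple maps, would be
semisimple and nilpotent, hence zero. -/
theorem HasNonzeroNilpotentPart.not_isSemisimple {ι : Type*} [Fintype ι] [DecidableEq ι]
    {B : Matrix ι ι ℝ} (hB : HasNonzeroNilpotentPart B) :
    ¬ Module.End.IsSemisimple (Matrix.toLin' B) := by
  obtain ⟨S, N, hS, hN, hSN, rfl, hN0⟩ := hB
  intro h
  have hcomm : Commute (Matrix.toLin' (S + N)) (Matrix.toLin' S) :=
    ((Commute.refl S).add_left hSN.symm).map Matrix.toLinAlgEquiv'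
  have hsub := h.sub_of_commute hcomm hS
  rw [map_add, add_sub_cancel_left] at hsub
  have hnil : IsNilpotent (Matrix.toLin' N) := hN.map Matrix.toLinAlgEquiv'
  exact hN0 ((LinearEquiv.map_eq_zero_iff _).1
    (Module.End.eq_zero_of_isNilpotent_isSemisimple hnil hsub))

theorem aeval_comp_of_comp_eq {V W : Type*} [AddCommGroup V] [Module ℝ V] [AddCommGroup W]
    [Module ℝ W] {T : Module.End ℝ V} {B : Module.End ℝ W} {π : V →ₗ[ℝ] W}
    (h : B ∘ₗ π = π ∘ₗ T) (p : ℝ[X]) : aeval B p ∘ₗ π = π ∘ₗ aeval T p := by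
  induction p using Polynomial.induction_on' with
  | add p q hp hq => rw [map_add, map_add, LinearMap.add_comp, LinearMap.comp_add, hp, hq]
  | monomial n r =>
    have := Module.End.commute_pow_left_of_commute h n
    rw [aeval_monomial, aeval_monomial, ← Algebra.smul_def, ← Algebra.smul_def,
      LinearMap.smul_comp, LinearMap.comp_smul, this]

theorem minpoly_dvd_of_comp_eq {V W : Type*} [AddCommGroup V] [Module ℝ V] [AddCommGroup W]
    [Module ℝ W] {T : Module.End ℝ V} {B : Module.End ℝ W} {π : V →ₗ[ℝ] W}
    (hπ : Function.Surjective π) (h : B ∘ₗ π = π ∘ₗ T) : minpoly ℝ B ∣ minpoly ℝ T := by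
  refine minpoly.dvd ℝ B ?_
  have := aeval_comp_of_comp_eq h (minpoly ℝ T)
  rw [minpoly.aeval, LinearMap.comp_zero] at this
  exact (LinearMap.cancel_right hπ).1 (by rw [this, LinearMap.zero_comp])

/-- An endomorphism with real eigenvalues that is not semisimple has an eigenvalue `lam` for which
the transpose has a Jordan block of size at least `2`. -/
theorem exists_jordan_chain {W : Type*} [AddCommGroup W] [Module ℝ W] [Module.Finite ℝ W]
    {B : Module.End ℝ W} (hs : (minpoly ℝ B).Splits) (hB : ¬ B.IsSemisimple) :
    ∃ (lam : ℝ) (χ θ : Dual ℝ W), B.HasEigenvalue lam ∧ θ ≠ 0 ∧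
      χ ∘ₗ B = lam • χ + θ ∧ θ ∘ₗ B = lam • θ := by
  have hp0 : minpoly ℝ B ≠ 0 := minpoly.ne_zero (Algebra.IsIntegral.isIntegral B)
  have hsq : ¬ Squarefree (minpoly ℝ B) := fun h =>
    hB (Module.End.isSemisimple_of_squarefree_aeval_eq_zero h (minpoly.aeval ℝ B))
  obtain ⟨lam, q, hq⟩ := exists_sq_dvd_of_not_squarefree hp0 hs hsq
  have hroot : (minpoly ℝ B).IsRoot lam := by
    rw [hq]
    simp
  -- Here `(X - lam)² q` is the minimal polynomial, so dropping one factor leaves a nonzero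
  -- operator; a functional `w` detecting it gives the chain `χ = w ∘ q(B)`, `θ = w ∘ (B - lam)
  -- q(B)`.
  have hr : aeval B ((X - C lam) * q) ≠ 0 := by
    intro h
    obtain ⟨s, hs⟩ := minpoly.dvd ℝ B h
    have hr0 : (X - C lam) * q ≠ 0 := by
      intro h0
      rw [mul_assoc, h0, mul_zero] at hq
      exact hp0 hq
    have h1 : (X - C lam) * q * ((X - C lam) * s) = (X - C lam) * q * 1 := by
      rw [mul_one]
      conv_rhs => rw [hs, hq]
      ring
    exact not_isUnit_X_sub_C lam (IsUnit.of_mul_eq_one _ (mul_left_cancel₀ hr0 h1))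
  obtain ⟨x, hx⟩ : ∃ x, aeval B ((X - C lam) * q) x ≠ 0 := by
    by_contra! h
    exact hr (LinearMap.ext h)
  obtain ⟨w, hw⟩ : ∃ w : Dual ℝ W, w (aeval B ((X - C lam) * q) x) ≠ 0 := by
    by_contra! h
    exact hx ((Module.forall_dual_apply_eq_zero_iff ℝ _).1 h)
  have hX : ∀ p : ℝ[X], aeval B p ∘ₗ B = lam • aeval B p + aeval B ((X - C lam) * p) := by
    intro p
    have h1 : aeval B (p * X) = aeval B (C lam * p + (X - C lam) * p) := by
      congr 1
      ring
    rw [map_mul, aeval_X, map_add, map_mul, aeval_C, ← Algebra.smul_def] at h1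
    exact h1
  refine ⟨lam, w ∘ₗ aeval B q, w ∘ₗ aeval B ((X - C lam) * q),
    Module.End.hasEigenvalue_of_isRoot hroot, fun h => hw (LinearMap.congr_fun h x), ?_, ?_⟩
  · rw [LinearMap.comp_assoc, hX, LinearMap.comp_add, LinearMap.comp_smul]
  · rw [LinearMap.comp_assoc, hX, ← mul_assoc, ← hq, minpoly.aeval, add_zero, LinearMap.comp_smul]

end LinearAlgebra

/-! ### The concrete Lie algebra `ℝ ⋉_A ℝ^ι`. -/

namespace AlmostAbelian

section General

variable {ι : Type*} [Fintype ι] (A : Matrix ι ι ℝ)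

/-- The vector `f₁`. -/
def f₁ : AlmostAbelian A := ((1, 0) : ℝ × (ι → ℝ))

/-- The coordinate of `f₁`. -/
def fst : Dual ℝ (AlmostAbelian A) := LinearMap.fst ℝ ℝ (ι → ℝ)

/-- The projection to the ideal `ℝ^ι` along `f₁`. -/
def snd : AlmostAbelian A →ₗ[ℝ] (ι → ℝ) := LinearMap.snd ℝ ℝ (ι → ℝ)

/-- The inclusion of the ideal `ℝ^ι`. -/
def inr : (ι → ℝ) →ₗ[ℝ] AlmostAbelian A := LinearMap.inr ℝ ℝ (ι → ℝ)

variable {A}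

theorem ext {x y : AlmostAbelian A} (h₁ : fst A x = fst A y) (h₂ : snd A x = snd A y) : x = y :=
  Prod.ext h₁ h₂

theorem fst_f₁ : fst A (f₁ A) = 1 := rfl

theorem snd_f₁ : snd A (f₁ A) = 0 := rfl

theorem fst_inr (u : ι → ℝ) : fst A (inr A u) = 0 := rfl

theorem snd_inr (u : ι → ℝ) : snd A (inr A u) = u := rfl

theorem fst_lie (x y : AlmostAbelian A) : fst A ⁅x, y⁆ = 0 := rfl

theorem snd_lie (x y : AlmostAbelian A) :
    snd A ⁅x, y⁆ = fst A x • A.mulVec (snd A y) - fst A y • A.mulVec (snd A x) := rfl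

theorem ad_f₁ (x : AlmostAbelian A) : LieAlgebra.ad ℝ _ (f₁ A) x = inr A (A.mulVec (snd A x)) := by
  refine ext ?_ ?_
  · rw [LieAlgebra.ad_apply, fst_lie, fst_inr]
  · rw [LieAlgebra.ad_apply, snd_lie, snd_inr, fst_f₁, snd_f₁, Matrix.mulVec_zero, smul_zero,
      sub_zero, one_smul]

theorem isAlmostAbelian :
    IsAlmostAbelian (fst A) (LieAlgebra.ad ℝ (AlmostAbelian A) (f₁ A)) (f₁ A) where
  lie x y := by
    refine ext ?_ ?_
    · simp [fst_lie]
    · simp [snd_lie, fst_f₁, snd_f₁]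
  apply_self := rfl
  comp_eq_zero := by
    ext x
    rw [LinearMap.comp_apply, ad_f₁, fst_inr, LinearMap.zero_apply]
  map_eq_zero := by rw [LieAlgebra.ad_apply, lie_self]

theorem finrank_eq : finrank ℝ (AlmostAbelian A) = Fintype.card ι + 1 := by
  change finrank ℝ (ℝ × (ι → ℝ)) = _
  simp [add_comm]

/-- A unimodular almost abelian Lie algebra `ℝ ⋉_A ℝ^ι` with `A` invertible is not symplectic. -/
theorem det_eq_zero_of_isSymplectic [DecidableEq ι] (hunim : IsUnimodular (AlmostAbelian A))
    {ω : Forms (AlmostAbelian A)} (hω : IsSymplectic ω) : A.det = 0 := by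
  by_contra hdet
  refine isAlmostAbelian.not_forall_exists_eq (hunim (f₁ A)) hω fun α =>
    -- On the ideal, `α = (α ∘ A⁻¹) ∘ A`; the multiple of `fst A` accounts for the value at `f₁`.
    ⟨α ∘ₗ inr A ∘ₗ Matrix.toLin' A⁻¹ ∘ₗ snd A, α (f₁ A), LinearMap.ext fun x => ?_⟩
  have hx : x = inr A (snd A x) + fst A x • f₁ A := by
    refine ext ?_ ?_
    · simp [fst_inr, fst_f₁]
    · simp [snd_inr, snd_f₁]
  have h1 : A⁻¹.mulVec (A.mulVec (snd A x)) = snd A x := by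
    rw [Matrix.mulVec_mulVec, Matrix.nonsing_inv_mul _ (isUnit_iff_ne_zero.2 hdet),
      Matrix.one_mulVec]
  conv_lhs => rw [hx]
  simp [snd_lie, fst_f₁, snd_f₁, h1, mul_comm]

end General

/-! ### The block matrix with `a = 0` and `A₀` invertible. -/

section Block

open Matrix

variable {m : ℕ} (v : Fin m → ℝ) (A₀ : Matrix (Fin m) (Fin m) ℝ)

/-- The matrix with the rows `(0, v)` and `(0, A₀)`. -/
abbrev singularBlock : Matrix (Fin 1 ⊕ Fin m) (Fin 1 ⊕ Fin m) ℝ :=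
  fromBlocks !![0] (replicateRow (Fin 1) v) 0 A₀

variable {v A₀}

theorem singularBlock_mulVec_inl (u : Fin 1 ⊕ Fin m → ℝ) (i : Fin 1) :
    (singularBlock v A₀ *ᵥ u) (Sum.inl i) = v ⬝ᵥ (u ∘ Sum.inr) := by
  rw [fromBlocks_mulVec, Sum.elim_inl]
  fin_cases i
  simp [mulVec, dotProduct]

theorem singularBlock_mulVec_inr (u : Fin 1 ⊕ Fin m → ℝ) :
    (singularBlock v A₀ *ᵥ u) ∘ Sum.inr = A₀ *ᵥ (u ∘ Sum.inr) := by
  rw [fromBlocks_mulVec, Sum.elim_comp_inr]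
  simp

variable (v A₀)

/-- The coordinate of the null vector of the matrix `singularBlock v A₀` (for invertible `A₀`) that
vanishes on the image of the matrix. -/
def kerCoord : Dual ℝ (AlmostAbelian (singularBlock v A₀)) :=
  (LinearMap.proj (Sum.inl 0)
    - dotProductBilin ℝ ℝ (v ᵥ* A₀⁻¹) ∘ₗ LinearMap.funLeft ℝ ℝ Sum.inr) ∘ₗ snd _

/-- The projection to `ℝ^m`. -/
def toBase : AlmostAbelian (singularBlock v A₀) →ₗ[ℝ] (Fin m → ℝ) :=
  LinearMap.funLeft ℝ ℝ Sum.inr ∘ₗ snd _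

variable {v A₀}

theorem kerCoord_apply (x : AlmostAbelian (singularBlock v A₀)) :
    kerCoord v A₀ x = snd _ x (Sum.inl 0) - (v ᵥ* A₀⁻¹) ⬝ᵥ (snd _ x ∘ Sum.inr) := rfl

theorem toBase_comp_ad : toLin' A₀ ∘ₗ toBase v A₀
    = toBase v A₀ ∘ₗ LieAlgebra.ad ℝ (AlmostAbelian (singularBlock v A₀)) (f₁ _) := by
  refine LinearMap.ext fun x => ?_
  rw [LinearMap.comp_apply, LinearMap.comp_apply, ad_f₁]
  exact (singularBlock_mulVec_inr (snd _ x)).symm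

theorem toBase_surjective : Function.Surjective (toBase v A₀) := fun y =>
  ⟨inr _ (Sum.elim 0 y), rfl⟩

theorem isSplitAlmostAbelian (hA₀ : IsUnit A₀.det) :
    IsSplitAlmostAbelian (fst _) (kerCoord v A₀)
      (LieAlgebra.ad ℝ (AlmostAbelian (singularBlock v A₀)) (f₁ _)) (f₁ _)
      (inr _ (Sum.elim 1 0)) where
  toIsAlmostAbelian := isAlmostAbelian
  fst_apply := rfl
  snd_apply_fst := by
    rw [kerCoord_apply, snd_f₁]
    have : (0 : Fin 1 ⊕ Fin m → ℝ) ∘ Sum.inr = 0 := rfl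
    simp [this]
  snd_apply := by
    rw [kerCoord_apply, snd_inr]
    simp
  snd_comp_eq_zero := by
    refine LinearMap.ext fun x => ?_
    rw [LinearMap.comp_apply, ad_f₁, kerCoord_apply, snd_inr, singularBlock_mulVec_inl,
      singularBlock_mulVec_inr, dotProduct_mulVec, vecMul_vecMul, nonsing_inv_mul _ hA₀,
      vecMul_one, sub_self, LinearMap.zero_apply]
  map_snd_eq_zero := by
    have h0 : singularBlock v A₀ *ᵥ Sum.elim 1 0 = 0 := by
      refine funext fun i => ?_
      rcases i with i | i
      · rw [singularBlock_mulVec_inl]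
        simp
      · have := congrFun (singularBlock_mulVec_inr (v := v) (A₀ := A₀) (Sum.elim 1 0)) i
        rw [Sum.elim_comp_inr, mulVec_zero] at this
        exact this
    rw [ad_f₁, snd_inr, h0, map_zero]
  eq_of_map_eq_zero x hx := by
    rw [ad_f₁] at hx
    have h1 : singularBlock v A₀ *ᵥ snd _ x = 0 := congrArg (snd _) hx
    have h2 : snd _ x ∘ Sum.inr = 0 := by
      have h3 := singularBlock_mulVec_inr (v := v) (A₀ := A₀) (snd _ x)
      rw [h1] at h3
      exact eq_zero_of_mulVec_eq_zero hA₀.ne_zero h3.symm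
    refine ext ?_ (funext fun i => ?_)
    · simp [fst_inr, fst_f₁]
    · rw [kerCoord_apply, h2]
      rcases i with i | i
      · fin_cases i
        simp [snd_inr, snd_f₁]
      · simpa [snd_inr, snd_f₁] using congrFun h2 i
  exists_eq_add_map x := by
    -- The image of this vector has first coordinate `v A₀⁻¹ u`, with `u` the `ℝ^m` part of `x`:
    -- exactly what `kerCoord` subtracts.
    refine ⟨inr _ (Sum.elim 0 (A₀⁻¹ *ᵥ (snd _ x ∘ Sum.inr))), ?_⟩
    rw [ad_f₁]
    refine ext ?_ (funext fun i => ?_)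
    · simp [fst_inr, fst_f₁]
    · rw [kerCoord_apply, snd_inr, map_add, map_add, map_smul, map_smul, snd_inr, snd_inr, snd_f₁,
        smul_zero, zero_add, Pi.add_apply, Pi.smul_apply]
      rcases i with i | i
      · rw [singularBlock_mulVec_inl, Sum.elim_comp_inr, dotProduct_mulVec]
        fin_cases i
        simp
      · have := congrFun (singularBlock_mulVec_inr (v := v) (A₀ := A₀)
          (Sum.elim 0 (A₀⁻¹ *ᵥ (snd _ x ∘ Sum.inr)))) i
        rw [Sum.elim_comp_inr, mulVec_mulVec, mul_nonsing_inv _ hA₀, one_mulVec] at this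
        rw [Function.comp_apply] at this
        rw [this]
        simp

theorem exists_eigenvector {lam : ℝ} (hlam : lam ≠ 0)
    (h : Module.End.HasEigenvalue (toLin' A₀) lam) :
    ∃ u : AlmostAbelian (singularBlock v A₀), u ≠ 0 ∧ LieAlgebra.ad ℝ _ (f₁ _) u = lam • u := by
  obtain ⟨z, hz⟩ := h.exists_hasEigenvector
  have hz1 : A₀ *ᵥ z = lam • z := hz.apply_eq_smul
  -- Lifting the eigenvector `z` of `A₀` forces the first coordinate `t` to satisfy `v · z = lam t`.
  refine ⟨inr _ (Sum.elim (fun _ => lam⁻¹ * (v ⬝ᵥ z)) z), fun h0 => hz.2 ?_, ?_⟩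
  · exact congrArg (toBase v A₀) h0
  · rw [ad_f₁, ← map_smul, snd_inr]
    congr 1
    refine funext fun i => ?_
    rcases i with i | i
    · rw [singularBlock_mulVec_inl]
      simp [hlam]
    · have := congrFun (singularBlock_mulVec_inr (v := v) (A₀ := A₀)
        (Sum.elim (fun _ => lam⁻¹ * (v ⬝ᵥ z)) z)) i
      rw [Sum.elim_comp_inr, hz1] at this
      exact this

theorem exists_jordan_data (hA₀ : IsUnit A₀.det)
    (hsolv : IsCompletelySolvable (AlmostAbelian (singularBlock v A₀)))
    (hnil : HasNonzeroNilpotentPart A₀) :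
    ∃ (lam : ℝ) (u : AlmostAbelian (singularBlock v A₀))
      (χ θ : Dual ℝ (AlmostAbelian (singularBlock v A₀))), lam ≠ 0 ∧ u ≠ 0 ∧
      LieAlgebra.ad ℝ _ (f₁ _) u = lam • u ∧ θ ≠ 0 ∧
      χ ∘ₗ LieAlgebra.ad ℝ _ (f₁ _) = lam • χ + θ ∧
      θ ∘ₗ LieAlgebra.ad ℝ _ (f₁ _) = lam • θ := by
  -- `A₀` is induced by `ad f₁` on a quotient, so its minimal polynomial divides that of `ad f₁`.
  have hsplit : (minpoly ℝ (toLin' A₀)).Splits :=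
    (hsolv.2 (f₁ _)).of_dvd (LinearMap.charpoly_monic _).ne_zero
      ((minpoly_dvd_of_comp_eq toBase_surjective toBase_comp_ad).trans
        (LinearMap.minpoly_dvd_charpoly _))
  obtain ⟨lam, χ, θ, heig, hθ0, hχ, hθ⟩ := exists_jordan_chain hsplit hnil.not_isSemisimple
  have hlam : lam ≠ 0 := by
    rintro rfl
    obtain ⟨z, hz⟩ := heig.exists_hasEigenvector
    have hz1 : A₀ *ᵥ z = (0 : ℝ) • z := hz.apply_eq_smul
    exact hz.2 (eq_zero_of_mulVec_eq_zero hA₀.ne_zero (by rw [hz1, zero_smul]))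
  obtain ⟨u, hu0, hu⟩ := exists_eigenvector (v := v) hlam heig
  refine ⟨lam, u, χ ∘ₗ toBase v A₀, θ ∘ₗ toBase v A₀, hlam, hu0, hu, fun h => hθ0 ?_, ?_, ?_⟩
  · exact (LinearMap.cancel_right toBase_surjective).1 (by rw [h, LinearMap.zero_comp])
  · rw [LinearMap.comp_assoc, ← toBase_comp_ad, ← LinearMap.comp_assoc, hχ, LinearMap.add_comp,
      LinearMap.smul_comp]
  · rw [LinearMap.comp_assoc, ← toBase_comp_ad, ← LinearMap.comp_assoc, hθ, LinearMap.smul_comp]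

theorem lefschetz_of_singularBlock (hA₀ : IsUnit A₀.det)
    (hsolv : IsCompletelySolvable (AlmostAbelian (singularBlock v A₀)))
    (hunim : IsUnimodular (AlmostAbelian (singularBlock v A₀)))
    (hnil : HasNonzeroNilpotentPart A₀)
    {ω : Forms (AlmostAbelian (singularBlock v A₀))} (hω : IsSymplectic ω) :
    hω.FailsAt 2 ∧ Function.Bijective (hω.lefschetz 1) := by
  have h := isSplitAlmostAbelian (v := v) hA₀
  have htr := hunim (f₁ _)
  obtain ⟨c, ω₀, ω', β, hN, hω', hβ⟩ := h.exists_isNormalForm htr hω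
  obtain ⟨n, hn, h0⟩ := hω'.exists_finrank_eq
  have hm : m ≠ 0 := by
    rintro rfl
    obtain ⟨S, N, -, -, -, -, hN0⟩ := hnil
    exact hN0 (Subsingleton.elim _ _)
  have hcard := finrank_eq (A := singularBlock v A₀)
  rw [Fintype.card_sum, Fintype.card_fin, Fintype.card_fin] at hcard
  -- The dimension `m + 2` is even and exceeds 2, because a nonzero nilpotent part needs `m > 0`.
  obtain ⟨n, rfl⟩ : ∃ k, n = k + 2 := ⟨n - 2, by omega⟩
  obtain ⟨lam, u, χ, θ, hlam, hu0, hu, hθ0, hχ, hθ⟩ := exists_jordan_data hA₀ hsolv hnil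
  refine ⟨⟨by omega, ?_⟩, ?_⟩
  · rw [IsSymplectic.lefschetz, hω.wedgePow_eq hω' hβ,
      show finrank ℝ (AlmostAbelian (singularBlock v A₀)) / 2 - 2 = n by omega]
    exact hN.ker_wedgePow_two_ne_bot h htr hω' hn hlam hu0 hu hθ0 hχ hθ
  · rw [IsSymplectic.lefschetz, hω.wedgePow_eq hω' hβ,
      show finrank ℝ (AlmostAbelian (singularBlock v A₀)) / 2 - 1 = n + 1 by omega]
    exact hN.bijective_wedgePow_one h htr hω' hn h0

end Block

end AlmostAbelian

end

end LieForms

theorem theorem4p13 (m : ℕ) (a : ℝ) (v : Fin m → ℝ) (A₀ : Matrix (Fin m) (Fin m) ℝ)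
    (A : Matrix (Fin 1 ⊕ Fin m) (Fin 1 ⊕ Fin m) ℝ)
    (hA : A = Matrix.fromBlocks !![a] (Matrix.replicateRow (Fin 1) v) 0 A₀)
    (hsolv : LieForms.IsCompletelySolvable (LieForms.AlmostAbelian A))
    (hunim : LieForms.IsUnimodular (LieForms.AlmostAbelian A))
    (hspec : (0 : ℝ) ∉ spectrum ℝ A₀)
    (hnil : LieForms.HasNonzeroNilpotentPart A₀)
    (ω : LieForms.Forms (LieForms.AlmostAbelian A)) (hω : LieForms.IsSymplectic ω) :
    ¬ hω.HardLefschetz ∧ hω.FailsAt 2 ∧ ¬ hω.FailsAt 1 ∧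
      Function.Bijective (hω.lefschetz 1) := by
  have hA₀ : IsUnit A₀.det :=
    (Matrix.isUnit_iff_isUnit_det A₀).1 (spectrum.zero_notMem_iff ℝ |>.1 hspec)
  -- `det A = a det A₀` vanishes, while `det A₀` does not.
  have ha : a = 0 := by
    have hdet := LieForms.AlmostAbelian.det_eq_zero_of_isSymplectic hunim hω
    rw [hA, Matrix.det_fromBlocks_zero₂₁] at hdet
    simpa using (mul_eq_zero.1 hdet).resolve_right hA₀.ne_zero
  subst ha
  subst hA
  obtain ⟨h2, h1⟩ :=
    LieForms.AlmostAbelian.lefschetz_of_singularBlock hA₀ hsolv hunim hnil hω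
  exact ⟨fun h => h2.2 (LinearMap.ker_eq_bot.2 (h 2 h2.1).1), h2,
    fun h => h.2 (LinearMap.ker_eq_bot.2 h1.1), h1⟩
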